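/- Let $\mathsf{HA}$ be intuitionistic first-order arithmetic with logical constants $\bot,\land,\lor,\to,\forall,\exists$ (where $\neg\varphi:=\varphi\to\bot$), equality, function symbols and defining equations for all primitive recursive functions, the successor axioms and full induction. Write $\mathrm{FV}(\varphi)$ for the set of free variables of $\varphi$. Let $\Sigma_0=\Pi_0$ be the class of quantifier-free formulas, and let $\Sigma_{k+1}$ (resp. $\Pi_{k+1}$) be the class of formulas $\exists\overline{x}\,\psi$ with $\psi\in\Pi_k$ (resp. $\forall\overline{x}\,\psi$ with $\psi\in\Sigma_k$), where $\overline{x}$ is a non-empty list of variables. For a class $\Gamma$ of formulas, $\Gamma\text{-}\mathrm{DNE}$ is the scheme $\forall x\,(\neg\neg\varphi(x)\to\varphi(x))$ with $\varphi\in\Gamma$ and $\mathrm{FV}(\varphi)\subseteq\{x\}$. To every formula $\varphi$ assign a finite set $\mathrm{Alt}(\varphi)$ of sequences of signs $+,-$ as follows, where $s^{\perp}$ is $s$ with all signs switched: $\mathrm{Alt}(\varphi)=\{\langle\,\rangle\}$ if $\varphi$ is quantifier-free; otherwise $\mathrm{Alt}(\neg\varphi)=\{s^\perp: s\in\mathrm{Alt}(\varphi)\}$;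 $\mathrm{Alt}(\varphi\land\psi)=\mathrm{Alt}(\varphi\lor\psi)=\mathrm{Alt}(\varphi)\cup\mathrm{Alt}(\psi)$; $\mathrm{Alt}(\varphi\to\psi)=\{s^\perp: s\in\mathrm{Alt}(\varphi)\}\cup\mathrm{Alt}(\psi)$ (for an implication that is not a negation); and $\mathrm{Alt}(\forall x\varphi)$ (resp. $\mathrm{Alt}(\exists x\varphi)$) is obtained from $\mathrm{Alt}(\varphi)$ by putting $-$ (resp. $+$) in front of every sequence that does not already begin with this sign. Let $\mathrm{F}_k$ be the class of formulas $\varphi$ for which the maximal length of a sequence in $\mathrm{Alt}(\varphi)$ is $k$. Let $\mathrm{U}_0=\mathrm{E}_0=\mathrm{F}_0$, let $\mathrm{U}_{k+1}$ (resp. $\mathrm{E}_{k+1}$) be the class of those $\varphi\in\mathrm{F}_{k+1}$ for which all sequences of length $k+1$ in $\mathrm{Alt}(\varphi)$ begin with $-$ (resp. $+$), and let $\mathrm{U}_k^+=\mathrm{U}_k\cup\bigcup_{i<k}\mathrm{F}_i$ and $\mathrm{E}_k^+=\mathrm{E}_k\cup\bigcup_{i<k}\mathrm{F}_i$. **Theorem.**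 Let $k$ be a natural number and let $\varphi$ be a formula, possibly with free variables, which does not contain $\lor$. 1. If $\varphi\in\mathrm{E}_k^+$, then there exists $\varphi'\in\Sigma_k$ such that $\mathrm{FV}(\varphi)=\mathrm{FV}(\varphi')$ and $\mathsf{HA}+\Sigma_k\text{-}\mathrm{DNE}\vdash\varphi\leftrightarrow\varphi'$. 2. If $\varphi\in\mathrm{U}_k^+$, then there exists $\varphi'\in\Pi_k$ such that $\mathrm{FV}(\varphi)=\mathrm{FV}(\varphi')$ and $\mathsf{HA}+\Sigma_{k-1}\text{-}\mathrm{DNE}\vdash\varphi\leftrightarrow\varphi'$ (just $\mathsf{HA}\vdash\varphi\leftrightarrow\varphi'$ if $k=0$). -/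

import Mathlib

namespace Arith

open FirstOrder

/-! ### The language of intuitionistic arithmetic -/

/-- Function symbols of arity `n`, one for every primitive recursive definition
(`0` is a nullary symbol; `prec f g` is defined by recursion on its first argument). -/
inductive PRSymb : ℕ → Type
  | zero : PRSymb 0
  | succ : PRSymb 1
  | proj {n : ℕ} (i : Fin n) : PRSymb n
  | comp {n m : ℕ} (f : PRSymb m) (g : Fin m → PRSymb n) : PRSymb n
  | prec {n : ℕ} (f : PRSymb n) (g : PRSymb (n + 2)) : PRSymb (n + 1)

/-- The first-order language with all these function symbols; equality is the only predicate. -/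
def lang : Language where
  Functions := PRSymb
  Relations := fun _ => Empty

/-- Terms. Variables are natural numbers, read as de Bruijn indices below quantifiers. -/
abbrev Tm : Type := lang.Term ℕ

/-- The variable with index `n`. -/
def Tm.v (n : ℕ) : Tm := Language.Term.var n

/-- Application of a function symbol. -/
def Tm.app {n : ℕ} (f : PRSymb n) (ts : Fin n → Tm) : Tm :=
  Language.Term.func (L := lang) f ts

/-- The constant `0`. -/
def Tm.zero : Tm := Tm.app PRSymb.zero Fin.elim0

/-- The term `S t`. -/
def Tm.succ (t : Tm) : Tm := Tm.app PRSymb.succ (fun _ => t)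

/-- Formulas. The quantifiers bind the variable with index `0` of their body. -/
inductive Formula : Type
  | bot : Formula
  | eq : Tm → Tm → Formula
  | and : Formula → Formula → Formula
  | or : Formula → Formula → Formula
  | imp : Formula → Formula → Formula
  | all : Formula → Formula
  | ex : Formula → Formula

namespace Formula

/-- Negation, an abbreviation as usual. -/
def neg (φ : Formula) : Formula := imp φ bot

/-- Bi-implication, an abbreviation as usual. -/
def iff (φ ψ : Formula) : Formula := and (imp φ ψ) (imp ψ φ)

/-- The set `FV(φ)` of free variables. -/
def FV : Formula → Set ℕ
  | bot => ∅
  | eq t s => ↑t.varFinset ∪ ↑s.varFinset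
  | and φ ψ => FV φ ∪ FV ψ
  | or φ ψ => FV φ ∪ FV ψ
  | imp φ ψ => FV φ ∪ FV ψ
  | all φ => {n | n + 1 ∈ FV φ}
  | ex φ => {n | n + 1 ∈ FV φ}

/-- A substitution, moved below a quantifier. -/
def up (σ : ℕ → Tm) : ℕ → Tm
  | 0 => Tm.v 0
  | n + 1 => (σ n).relabel Nat.succ

/-- Simultaneous capture-avoiding substitution. -/
def subst : (ℕ → Tm) → Formula → Formula
  | _, bot => bot
  | σ, eq t s => eq (t.subst σ) (s.subst σ)
  | σ, and φ ψ => and (subst σ φ) (subst σ ψ)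
  | σ, or φ ψ => or (subst σ φ) (subst σ ψ)
  | σ, imp φ ψ => imp (subst σ φ) (subst σ ψ)
  | σ, all φ => all (subst (up σ) φ)
  | σ, ex φ => ex (subst (up σ) φ)

/-- Renaming `n ↦ n + 1` of the free variables: the formula, placed below one more quantifier. -/
def shift (φ : Formula) : Formula := subst (fun n => Tm.v (n + 1)) φ

/-- The substitution `0 ↦ t`, `n + 1 ↦ n`. -/
def single (t : Tm) : ℕ → Tm
  | 0 => t
  | n + 1 => Tm.v n

/-- The instance `φ(t)` of the body `φ(x)` of a quantified formula. -/
def inst (φ : Formula) (t : Tm) : Formula := subst (single t) φ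

/-- `φ(S x)` for a formula `φ(x)`, where `x` is the variable with index `0`. -/
def atSucc (φ : Formula) : Formula :=
  subst (fun n => match n with
    | 0 => Tm.succ (Tm.v 0)
    | m + 1 => Tm.v (m + 1)) φ

/-- Quantifier-free formulas. -/
def QF : Formula → Prop
  | bot => True
  | eq _ _ => True
  | and φ ψ => QF φ ∧ QF ψ
  | or φ ψ => QF φ ∧ QF ψ
  | imp φ ψ => QF φ ∧ QF ψ
  | all _ => False
  | ex _ => False

/-- Formulas which do not contain `∨`. -/
def DisjFree : Formula → Prop
  | bot => True
  | eq _ _ => True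
  | and φ ψ => DisjFree φ ∧ DisjFree ψ
  | or _ _ => False
  | imp φ ψ => DisjFree φ ∧ DisjFree ψ
  | all φ => DisjFree φ
  | ex φ => DisjFree φ

end Formula

/-! ### Derivability and Heyting arithmetic -/

open Formula in
/-- Natural deduction for intuitionistic first-order logic with equality, with the axioms `T`
(an axiom with free variables stands for its universal closure) and open assumptions `Γ`. -/
inductive Deriv (T : Set Formula) : List Formula → Formula → Prop
  | ax {Γ φ} : φ ∈ T → Deriv T Γ φ
  | hyp {Γ φ} : φ ∈ Γ → Deriv T Γ φ
  | botE {Γ φ} : Deriv T Γ bot → Deriv T Γ φ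
  | andI {Γ φ ψ} : Deriv T Γ φ → Deriv T Γ ψ → Deriv T Γ (and φ ψ)
  | andE₁ {Γ φ ψ} : Deriv T Γ (and φ ψ) → Deriv T Γ φ
  | andE₂ {Γ φ ψ} : Deriv T Γ (and φ ψ) → Deriv T Γ ψ
  | orI₁ {Γ φ ψ} : Deriv T Γ φ → Deriv T Γ (or φ ψ)
  | orI₂ {Γ φ ψ} : Deriv T Γ ψ → Deriv T Γ (or φ ψ)
  | orE {Γ φ ψ χ} : Deriv T Γ (or φ ψ) → Deriv T (φ :: Γ) χ → Deriv T (ψ :: Γ) χ → Deriv T Γ χ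
  | impI {Γ φ ψ} : Deriv T (φ :: Γ) ψ → Deriv T Γ (imp φ ψ)
  | impE {Γ φ ψ} : Deriv T Γ (imp φ ψ) → Deriv T Γ φ → Deriv T Γ ψ
  | allI {Γ φ} : Deriv T (Γ.map shift) φ → Deriv T Γ (all φ)
  | allE {Γ φ} (t : Tm) : Deriv T Γ (all φ) → Deriv T Γ (inst φ t)
  | exI {Γ φ} (t : Tm) : Deriv T Γ (inst φ t) → Deriv T Γ (ex φ)
  | exE {Γ φ ψ} : Deriv T Γ (ex φ) → Deriv T (φ :: Γ.map shift) (shift ψ) → Deriv T Γ ψ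
  | eqI {Γ} (t : Tm) : Deriv T Γ (eq t t)
  | eqE {Γ t s} (φ : Formula) : Deriv T Γ (eq t s) → Deriv T Γ (inst φ t) → Deriv T Γ (inst φ s)

/-- `T ⊢ φ`. -/
def Proves (T : Set Formula) (φ : Formula) : Prop := Deriv T [] φ

/-- The non-logical axioms of `HA`: the successor axioms, the defining equations of all primitive
recursive function symbols, and the scheme of induction for all formulas. -/
inductive HA : Set Formula
  | succ_ne_zero (t : Tm) : HA (Formula.neg (Formula.eq t.succ Tm.zero))
  | succ_inj (t s : Tm) : HA (Formula.imp (Formula.eq t.succ s.succ) (Formula.eq t s))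
  | proj {n : ℕ} (i : Fin n) (ts : Fin n → Tm) :
      HA (Formula.eq (Tm.app (PRSymb.proj i) ts) (ts i))
  | comp {n m : ℕ} (f : PRSymb m) (g : Fin m → PRSymb n) (ts : Fin n → Tm) :
      HA (Formula.eq (Tm.app (PRSymb.comp f g) ts) (Tm.app f (fun i => Tm.app (g i) ts)))
  | prec_zero {n : ℕ} (f : PRSymb n) (g : PRSymb (n + 2)) (ts : Fin n → Tm) :
      HA (Formula.eq (Tm.app (PRSymb.prec f g) (Fin.cons Tm.zero ts)) (Tm.app f ts))
  | prec_succ {n : ℕ} (f : PRSymb n) (g : PRSymb (n + 2)) (t : Tm) (ts : Fin n → Tm) :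
      HA (Formula.eq (Tm.app (PRSymb.prec f g) (Fin.cons t.succ ts))
        (Tm.app g (Fin.cons t (Fin.cons (Tm.app (PRSymb.prec f g) (Fin.cons t ts)) ts))))
  | induction (φ : Formula) :
      HA (Formula.imp (φ.inst Tm.zero)
        (Formula.imp (Formula.all (Formula.imp φ φ.atSucc)) (Formula.all φ)))

/-- The scheme of double negation elimination `Γ-DNE`: all sentences `∀ x (¬¬φ(x) → φ(x))`, where
`φ(x)` is in `Γ` and has no free variable except possibly `x`. -/
def DNE (Γ : Set Formula) : Set Formula :=
  {χ | ∃ φ ∈ Γ, φ.FV ⊆ {0} ∧ χ = Formula.all (Formula.imp φ.neg.neg φ)}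

/-! ### The classes `Σ_k` and `Π_k` -/

mutual

/-- `Σ_k`: `k` alternating non-empty blocks of quantifiers, the first one existential, in front of
a quantifier-free formula. -/
def SigmaCl : ℕ → Set Formula
  | 0 => {φ | φ.QF}
  | k + 1 => {φ | ∃ ψ ∈ PiCl k, ∃ n : ℕ, φ = Formula.ex^[n + 1] ψ}

/-- `Π_k`: `k` alternating non-empty blocks of quantifiers, the first one universal, in front of
a quantifier-free formula. -/
def PiCl : ℕ → Set Formula
  | 0 => {φ | φ.QF}
  | k + 1 => {φ | ∃ ψ ∈ SigmaCl k, ∃ n : ℕ, φ = Formula.all^[n + 1] ψ}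

end

/-! ### Alternation paths and the classes `F_k`, `U_k`, `E_k`, `U_k⁺`, `E_k⁺` -/

/-- Paths are lists of signs, with `true` for `+` and `false` for `-`; `s^⊥` switches all signs. -/
def perp (s : List Bool) : List Bool := s.map not

/-- Adding a quantifier of sign `b`: a path that starts with `b` stays, any other path (also the
empty one) gets `b` in front. -/
def addSign (b : Bool) (A : Finset (List Bool)) : Finset (List Bool) :=
  A.filter (fun s => s.head? = some b) ∪
    (A.filter (fun s => s.head? ≠ some b)).image (fun s => b :: s)

/-- The set `Alt(φ)` of alternation paths of `φ`, with a separate clause for negations. For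
quantifier-free `φ` the clauses give `{⟨⟩}`, see `alt_of_qf`. -/
def alt : Formula → Finset (List Bool)
  | .bot => {[]}
  | .eq _ _ => {[]}
  | .and φ ψ => alt φ ∪ alt ψ
  | .or φ ψ => alt φ ∪ alt ψ
  | .imp φ .bot => (alt φ).image perp
  | .imp φ ψ => (alt φ).image perp ∪ alt ψ
  | .all φ => addSign false (alt φ)
  | .ex φ => addSign true (alt φ)

theorem alt_of_qf (φ : Formula) (h : φ.QF) : alt φ = {[]} := by
  induction φ with
  | bot => simp [alt]
  | eq t s => simp [alt]
  | and φ ψ h₁ h₂ => simp [alt, h₁ h.1, h₂ h.2]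
  | or φ ψ h₁ h₂ => simp [alt, h₁ h.1, h₂ h.2]
  | imp φ ψ h₁ h₂ => cases ψ <;> simp_all [alt, perp, Formula.QF]
  | all φ _ => exact h.elim
  | ex φ _ => exact h.elim

/-- The degree of `φ`: the maximal length of its alternation paths. -/
def degree (φ : Formula) : ℕ := (alt φ).sup List.length

/-- The class `F_k`. -/
def FCl (k : ℕ) : Set Formula := {φ | degree φ = k}

/-- The class `U_k`. -/
def UCl : ℕ → Set Formula
  | 0 => FCl 0
  | k + 1 => {φ | φ ∈ FCl (k + 1) ∧
      ∀ s ∈ alt φ, s.length = k + 1 → s.head? = some false}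

/-- The class `E_k`. -/
def ECl : ℕ → Set Formula
  | 0 => FCl 0
  | k + 1 => {φ | φ ∈ FCl (k + 1) ∧
      ∀ s ∈ alt φ, s.length = k + 1 → s.head? = some true}

/-- The class `U_k⁺ = U_k ∪ ⋃ i < k, F_i`. -/
def UPlus (k : ℕ) : Set Formula := UCl k ∪ ⋃ i < k, FCl i

/-- The class `E_k⁺ = E_k ∪ ⋃ i < k, F_i`. -/
def EPlus (k : ℕ) : Set Formula := ECl k ∪ ⋃ i < k, FCl i

end Arith

-- The classical prenex algorithm is run on `φ`, and the point is how much double negation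
-- elimination it costs. Some of its steps, such as `(∀ x α) → γ` to `∃ x (α → γ)`, are not
-- intuitionistic equivalences. They do hold in the weaker sense of `Repr`: the prenex form `δ`
-- implies the original formula, and the original formula implies `¬¬δ`. By induction on `φ`
-- (`exists_prenex`), every disjunction-free formula in `E_k⁺` or `U_k⁺` is represented in this
-- sense by a `Σ_k` or `Π_k` formula, over `Th k`, that is, `HA` with `Σ_j-DNE` for `j < k` only. A
-- representing formula that is stable is equivalent to the original one. A `Π_k` formula with `k >
-- 0` is stable over `Th k`, since a universal quantifier preserves the stability of its `Σ_{k-1}`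
-- body; a `Σ_k` formula is stable over `Th (k + 1)`. This accounts for the different theories in
-- the two claims.
--
-- The induction survives with so little DNE because stability is needed only in certain places. `∃`
-- and `∧` preserve representation outright, `∀` needs a stable body, and an implication needs a
-- stable premise or a stable conclusion. Premise and conclusion of an implication are put into dual
-- classes, so one of them is `Π` and hence stable (`Repr.imp`, `repr_all_imp`, `exists_imp`).
--
-- The scheme DNE allows only one parameter, while the formulas met on the way have many. Several
-- parameters are packed into one by Cantor's pairing function, whose projection equations are
-- derived in `HA` (`fst_pair`, `snd_pair`, `stable_of_dne`).

namespace Arith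

open FirstOrder

-- Substitution in terms

namespace Tm

theorem ext_cases {P : Tm → Prop} (hv : ∀ n, P (v n))
    (ha : ∀ {n : ℕ} (f : PRSymb n) (ts : Fin n → Tm), (∀ i, P (ts i)) → P (app f ts)) (t : Tm) :
    P t := by
  induction t with
  | var n => exact hv n
  | func f ts ih => exact ha f ts ih

@[simp] theorem subst_v (n : ℕ) (σ : ℕ → Tm) : (v n).subst σ = σ n := rfl

@[simp] theorem subst_app {n : ℕ} (f : PRSymb n) (ts : Fin n → Tm) (σ : ℕ → Tm) :
    (app f ts).subst σ = app f (fun i => (ts i).subst σ) := rfl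

@[simp] theorem subst_zero (σ : ℕ → Tm) : Tm.zero.subst σ = Tm.zero :=
  congrArg (app PRSymb.zero) (Subsingleton.elim _ _)

@[simp] theorem subst_succ (t : Tm) (σ : ℕ → Tm) : (Tm.succ t).subst σ = Tm.succ (t.subst σ) := rfl

@[simp] theorem subst_v_id (t : Tm) : t.subst v = t := by
  induction t using ext_cases with
  | hv n => rfl
  | ha f ts ih => simp [ih]

@[simp] theorem subst_subst (t : Tm) (σ τ : ℕ → Tm) :
    (t.subst σ).subst τ = t.subst (fun n => (σ n).subst τ) := by
  induction t using ext_cases with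
  | hv n => rfl
  | ha f ts ih => simp [ih]

@[simp] theorem relabel_eq_subst (t : Tm) (g : ℕ → ℕ) :
    t.relabel g = t.subst (fun n => v (g n)) := by
  induction t using ext_cases with
  | hv n => rfl
  | ha f ts ih => exact congrArg (app f) (funext ih)

theorem mem_varFinset_app {n : ℕ} (f : PRSymb n) (ts : Fin n → Tm) (m : ℕ) :
    m ∈ (app f ts).varFinset ↔ ∃ i, m ∈ (ts i).varFinset := by
  simp [app, Language.Term.varFinset]

theorem mem_varFinset_v (n m : ℕ) : m ∈ (v n).varFinset ↔ m = n := by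
  simp [v, Language.Term.varFinset]

theorem mem_varFinset_subst (t : Tm) (σ : ℕ → Tm) (m : ℕ) :
    m ∈ (t.subst σ).varFinset ↔ ∃ n ∈ t.varFinset, m ∈ (σ n).varFinset := by
  induction t using ext_cases with
  | hv n => simp [mem_varFinset_v]
  | ha f ts ih =>
    simp only [subst_app, mem_varFinset_app, ih]
    exact ⟨fun ⟨i, n, h, h'⟩ => ⟨n, ⟨i, h⟩, h'⟩, fun ⟨n, ⟨i, h⟩, h'⟩ => ⟨i, n, h, h'⟩⟩

theorem subst_congr (t : Tm) {σ τ : ℕ → Tm} (h : ∀ n ∈ t.varFinset, σ n = τ n) :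
    t.subst σ = t.subst τ := by
  induction t using ext_cases with
  | hv n => exact h n (by simp [mem_varFinset_v])
  | ha f ts ih =>
    simp only [subst_app]
    congr 1
    funext i
    exact ih i fun n hn => h n ((mem_varFinset_app _ _ _).2 ⟨i, hn⟩)

end Tm

-- Substitution and free variables in formulas

namespace Formula

@[simp] theorem up_zero (σ : ℕ → Tm) : up σ 0 = Tm.v 0 := rfl

@[simp] theorem up_succ (σ : ℕ → Tm) (n : ℕ) :
    up σ (n + 1) = (σ n).subst (fun n => Tm.v (n + 1)) := by simp [up]

@[simp] theorem single_zero (t : Tm) : single t 0 = t := rfl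

@[simp] theorem single_succ (t : Tm) (n : ℕ) : single t (n + 1) = Tm.v n := rfl

theorem up_v : up Tm.v = Tm.v := by funext n; cases n <;> simp

theorem subst_v_id (φ : Formula) : φ.subst Tm.v = φ := by
  induction φ <;> simp_all [subst, up_v]

theorem up_comp (σ τ : ℕ → Tm) :
    (fun n => (up σ n).subst (up τ)) = up (fun n => (σ n).subst τ) := by
  funext n; cases n <;> simp

theorem subst_subst (φ : Formula) (σ τ : ℕ → Tm) :
    (φ.subst σ).subst τ = φ.subst (fun n => (σ n).subst τ) := by
  induction φ generalizing σ τ <;> simp_all [subst, up_comp]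

theorem mem_FV_subst (φ : Formula) (σ : ℕ → Tm) (m : ℕ) :
    m ∈ (φ.subst σ).FV ↔ ∃ n ∈ φ.FV, m ∈ (σ n).varFinset := by
  have key : ∀ (ψ : Formula), (∀ σ m, m ∈ (ψ.subst σ).FV ↔ ∃ n ∈ ψ.FV, m ∈ (σ n).varFinset) →
      ∀ σ m, m + 1 ∈ (ψ.subst (up σ)).FV ↔ ∃ n, n + 1 ∈ ψ.FV ∧ m ∈ (σ n).varFinset := by
    intro ψ ih σ m
    rw [ih]
    constructor
    · rintro ⟨_ | n, hn, hm⟩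
      · simp [Tm.mem_varFinset_v] at hm
      · rw [up_succ, Tm.mem_varFinset_subst] at hm
        obtain ⟨j, hj, hm⟩ := hm
        rw [Tm.mem_varFinset_v, add_left_inj] at hm
        exact ⟨n, hn, hm ▸ hj⟩
    · rintro ⟨n, hn, hm⟩
      refine ⟨n + 1, hn, ?_⟩
      rw [up_succ, Tm.mem_varFinset_subst]
      exact ⟨m, hm, by simp [Tm.mem_varFinset_v]⟩
  induction φ generalizing σ m with
  | bot => simp [subst, FV]
  | eq t s => simp [subst, FV, Tm.mem_varFinset_subst, or_and_right, exists_or]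
  | and φ ψ h₁ h₂ => simp [subst, FV, h₁, h₂, or_and_right, exists_or]
  | or φ ψ h₁ h₂ => simp [subst, FV, h₁, h₂, or_and_right, exists_or]
  | imp φ ψ h₁ h₂ => simp [subst, FV, h₁, h₂, or_and_right, exists_or]
  | all φ ih => exact key φ ih σ m
  | ex φ ih => exact key φ ih σ m

theorem subst_congr (φ : Formula) {σ τ : ℕ → Tm} (h : ∀ n ∈ φ.FV, σ n = τ n) :
    φ.subst σ = φ.subst τ := by
  have key : ∀ (ψ : Formula) (σ τ : ℕ → Tm), (∀ n, n + 1 ∈ ψ.FV → σ n = τ n) →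
      ∀ n ∈ ψ.FV, up σ n = up τ n := by
    rintro ψ σ τ h (_ | n) hn
    · rfl
    · simp [h n hn]
  induction φ generalizing σ τ with
  | bot => rfl
  | eq t s =>
    simp only [subst]
    rw [Tm.subst_congr t fun n hn => h n (Or.inl hn),
      Tm.subst_congr s fun n hn => h n (Or.inr hn)]
  | and φ ψ h₁ h₂ | or φ ψ h₁ h₂ | imp φ ψ h₁ h₂ =>
    simp only [subst]
    rw [h₁ fun n hn => h n (Or.inl hn), h₂ fun n hn => h n (Or.inr hn)]
  | all φ ih | ex φ ih =>
    simp only [subst]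
    rw [ih (key φ σ τ h)]

theorem mem_FV_shift (φ : Formula) (m : ℕ) : m + 1 ∈ φ.shift.FV ↔ m ∈ φ.FV := by
  simp [shift, mem_FV_subst, Tm.mem_varFinset_v]

theorem shift_inst (φ : Formula) (t : Tm) : φ.shift.inst t = φ := by
  simp [shift, inst, subst_subst, subst_v_id]

theorem inst_subst (φ : Formula) (σ : ℕ → Tm) (t : Tm) :
    (φ.subst (up σ)).inst t = φ.subst (fun n => match n with | 0 => t | n + 1 => σ n) := by
  rw [inst, subst_subst]
  congr 1
  funext n
  cases n <;> simp

theorem up_shift_inst (φ : Formula) :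
    (φ.subst (up fun n => Tm.v (n + 1))).inst (Tm.v 0) = φ := by
  rw [inst_subst]
  conv_rhs => rw [← subst_v_id φ]
  congr 1
  funext n
  cases n <;> rfl

/-- The bound counts the parameters that pairing has to merge in `dne_subst`. -/
theorem exists_FV_lt (φ : Formula) : ∃ n, ∀ m ∈ φ.FV, m < n := by
  suffices h : φ.FV.Finite by
    obtain ⟨n, hn⟩ := h.bddAbove
    exact ⟨n + 1, fun m hm => Nat.lt_succ_of_le (hn hm)⟩
  induction φ with
  | bot => exact Set.finite_empty
  | eq t s => exact (Finset.finite_toSet _).union (Finset.finite_toSet _)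
  | and φ ψ h₁ h₂ | or φ ψ h₁ h₂ | imp φ ψ h₁ h₂ => exact h₁.union h₂
  | all φ ih | ex φ ih => exact ih.preimage (Nat.succ_injective.injOn)

end Formula

-- Derived rules of natural deduction

namespace Deriv

open Formula

variable {T : Set Formula} {Γ Δ : List Formula} {φ ψ χ : Formula}

theorem weaken (h : Deriv T Γ φ) (hΓ : Γ ⊆ Δ) : Deriv T Δ φ := by
  induction h generalizing Δ with
  | ax h => exact ax h
  | hyp h => exact hyp (hΓ h)
  | botE _ ih => exact botE (ih hΓ)
  | andI _ _ ih₁ ih₂ => exact andI (ih₁ hΓ) (ih₂ hΓ)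
  | andE₁ _ ih => exact andE₁ (ih hΓ)
  | andE₂ _ ih => exact andE₂ (ih hΓ)
  | orI₁ _ ih => exact orI₁ (ih hΓ)
  | orI₂ _ ih => exact orI₂ (ih hΓ)
  | orE _ _ _ ih₁ ih₂ ih₃ =>
    exact orE (ih₁ hΓ) (ih₂ (List.cons_subset_cons _ hΓ)) (ih₃ (List.cons_subset_cons _ hΓ))
  | impI _ ih => exact impI (ih (List.cons_subset_cons _ hΓ))
  | impE _ _ ih₁ ih₂ => exact impE (ih₁ hΓ) (ih₂ hΓ)
  | allI _ ih => exact allI (ih (List.map_subset _ hΓ))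
  | allE t _ ih => exact allE t (ih hΓ)
  | exI t _ ih => exact exI t (ih hΓ)
  | exE _ _ ih₁ ih₂ =>
    exact exE (ih₁ hΓ) (ih₂ (List.cons_subset_cons _ (List.map_subset _ hΓ)))
  | eqI t => exact eqI t
  | eqE φ _ _ ih₁ ih₂ => exact eqE φ (ih₁ hΓ) (ih₂ hΓ)

theorem change_axioms {T' : Set Formula} (h : Deriv T Γ φ) (hT : ∀ χ ∈ T, Proves T' χ) :
    Deriv T' Γ φ := by
  induction h with
  | ax h => exact (hT _ h).weaken (by simp)
  | hyp h => exact hyp h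
  | botE _ ih => exact botE ih
  | andI _ _ ih₁ ih₂ => exact andI ih₁ ih₂
  | andE₁ _ ih => exact andE₁ ih
  | andE₂ _ ih => exact andE₂ ih
  | orI₁ _ ih => exact orI₁ ih
  | orI₂ _ ih => exact orI₂ ih
  | orE _ _ _ ih₁ ih₂ ih₃ => exact orE ih₁ ih₂ ih₃
  | impI _ ih => exact impI ih
  | impE _ _ ih₁ ih₂ => exact impE ih₁ ih₂
  | allI _ ih => exact allI ih
  | allE t _ ih => exact allE t ih
  | exI t _ ih => exact exI t ih
  | exE _ _ ih₁ ih₂ => exact exE ih₁ ih₂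
  | eqI t => exact eqI t
  | eqE φ _ _ ih₁ ih₂ => exact eqE φ ih₁ ih₂

theorem of_proves (h : Proves T φ) : Deriv T Γ φ := weaken h (by simp)

theorem mp (h : Proves T (imp φ ψ)) (h' : Deriv T Γ φ) : Deriv T Γ ψ := impE (of_proves h) h'

theorem h0 : Deriv T (φ :: Γ) φ := hyp (by simp)
theorem h1 : Deriv T (ψ :: φ :: Γ) φ := hyp (by simp)
theorem h2 : Deriv T (χ :: ψ :: φ :: Γ) φ := hyp (by simp)

theorem wk (h : Deriv T Γ φ) : Deriv T (ψ :: Γ) φ := h.weaken (by simp)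

/-- Elimination of a shifted universal hypothesis at the fresh variable. -/
theorem allE_v (h : Deriv T Γ (all φ).shift) : Deriv T Γ φ := by
  have := allE (Tm.v 0) (φ := φ.subst (up fun n => Tm.v (n + 1))) h
  rwa [up_shift_inst] at this

/-- Introduction of a shifted existential statement with the fresh variable as witness. -/
theorem exI_v (h : Deriv T Γ φ) : Deriv T Γ (ex φ).shift := by
  refine exI (Tm.v 0) (φ := φ.subst (up fun n => Tm.v (n + 1))) ?_
  rwa [up_shift_inst]

end Deriv

end Arith

namespace Arith

open FirstOrder Formula Deriv

/-! ### Equational reasoning -/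

/-- Derivable equality of terms. -/
abbrev EqD (T : Set Formula) (Γ : List Formula) (t s : Tm) : Prop := Deriv T Γ (eq t s)

namespace EqD

variable {T : Set Formula} {Γ : List Formula} {t s r : Tm}

theorem congr_subst (u : Tm) (h : EqD T Γ t s) :
    EqD T Γ (u.subst (single t)) (u.subst (single s)) := by
  have := eqE (eq ((u.subst (single t)).subst fun n => Tm.v (n + 1)) u) h
    (by simpa [inst, subst] using eqI _)
  simpa [inst, subst] using this

theorem symm (h : EqD T Γ t s) : EqD T Γ s t := by
  have := eqE (eq (Tm.v 0) (t.subst fun n => Tm.v (n + 1))) h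
    (by simpa [inst, subst] using eqI _)
  simpa [inst, subst] using this

theorem trans (h : EqD T Γ t s) (h' : EqD T Γ s r) : EqD T Γ t r := by
  have := eqE (eq (t.subst fun n => Tm.v (n + 1)) (Tm.v 0)) h'
    (by simpa [inst, subst] using h)
  simpa [inst, subst] using this

instance : Trans (EqD T Γ) (EqD T Γ) (EqD T Γ) := ⟨trans⟩

end EqD

namespace Tm

@[simp high] theorem subst_app1 (f : PRSymb 1) (a : Tm) (σ : ℕ → Tm) :
    (app f ![a]).subst σ = app f ![a.subst σ] := by
  rw [subst_app]
  congr 1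
  funext i; fin_cases i; rfl

@[simp high] theorem subst_app2 (f : PRSymb 2) (a b : Tm) (σ : ℕ → Tm) :
    (app f ![a, b]).subst σ = app f ![a.subst σ, b.subst σ] := by
  rw [subst_app]
  congr 1
  funext i; fin_cases i <;> rfl

@[simp high] theorem subst_app3 (f : PRSymb 3) (a b c : Tm) (σ : ℕ → Tm) :
    (app f ![a, b, c]).subst σ = app f ![a.subst σ, b.subst σ, c.subst σ] := by
  rw [subst_app]
  congr 1
  funext i; fin_cases i <;> rfl

end Tm

namespace EqD

variable {T : Set Formula} {Γ : List Formula} {a a' b b' c c' : Tm}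

theorem app1 (f : PRSymb 1) (h : EqD T Γ a a') : EqD T Γ (Tm.app f ![a]) (Tm.app f ![a']) := by
  simpa using h.congr_subst (Tm.app f ![Tm.v 0])

theorem app2 (f : PRSymb 2) (h : EqD T Γ a a') (h' : EqD T Γ b b') :
    EqD T Γ (Tm.app f ![a, b]) (Tm.app f ![a', b']) := by
  refine EqD.trans (s := Tm.app f ![a', b]) ?_ ?_
  · simpa using h.congr_subst (Tm.app f ![Tm.v 0, b.subst fun n => Tm.v (n + 1)])
  · simpa using h'.congr_subst (Tm.app f ![a'.subst fun n => Tm.v (n + 1), Tm.v 0])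

theorem app3 (f : PRSymb 3) (h : EqD T Γ a a') (h' : EqD T Γ b b') (h'' : EqD T Γ c c') :
    EqD T Γ (Tm.app f ![a, b, c]) (Tm.app f ![a', b', c']) := by
  refine EqD.trans (s := Tm.app f ![a', b', c]) (EqD.trans (s := Tm.app f ![a', b, c]) ?_ ?_) ?_
  · simpa using h.congr_subst
      (Tm.app f ![Tm.v 0, b.subst fun n => Tm.v (n + 1), c.subst fun n => Tm.v (n + 1)])
  · simpa using h'.congr_subst
      (Tm.app f ![a'.subst fun n => Tm.v (n + 1), Tm.v 0, c.subst fun n => Tm.v (n + 1)])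
  · simpa using h''.congr_subst
      (Tm.app f ![a'.subst fun n => Tm.v (n + 1), b'.subst fun n => Tm.v (n + 1), Tm.v 0])

theorem succ (h : EqD T Γ a a') : EqD T Γ (Tm.succ a) (Tm.succ a') := by
  simpa using h.congr_subst (Tm.succ (Tm.v 0))

end EqD

/-! ### Some primitive recursive functions -/

namespace PRSymb

/-- The predecessor. -/
def pred : PRSymb 1 := prec zero (proj 0)

/-- Addition, by recursion on the first argument. -/
def add : PRSymb 2 := prec (proj 0) (comp succ ![proj 1])

/-- `rsub y x` is the truncated difference `x - y`. -/
def rsub : PRSymb 2 := prec (proj 0) (comp pred ![proj 1])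

/-- The triangular numbers. -/
def tri : PRSymb 1 := prec zero (comp succ ![comp add ![proj 0, proj 1] ])

/-- Definition by cases: `ite c a b` is `a` if `c = 0`, and `b` otherwise. -/
def ite : PRSymb 3 := prec (proj 0) (proj 3)

/-- The number of the diagonal on which the pair with a given code lies. -/
def diag : PRSymb 1 :=
  prec zero (comp ite ![comp rsub ![comp succ ![proj 0], comp tri ![comp succ ![proj 1] ] ],
    comp succ ![proj 1], proj 1])

/-- Cantor's pairing function. -/
def pair : PRSymb 2 := comp add ![proj 0, comp tri ![add] ]

/-- The first component of a coded pair. -/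
def fst : PRSymb 1 := comp rsub ![comp tri ![diag], proj 0]

/-- The second component of a coded pair. -/
def snd : PRSymb 1 := comp rsub ![fst, diag]

end PRSymb

namespace Tm

/-- The term `S t`, with the arguments of `S` written as a vector. -/
theorem succ_eq (t : Tm) : Tm.succ t = app PRSymb.succ ![t] := by
  unfold Tm.succ
  congr 1
  funext i
  fin_cases i
  rfl

/-- The term for the predecessor. -/
def pred (t : Tm) : Tm := app PRSymb.pred ![t]
/-- The term for a sum. -/
def add (t s : Tm) : Tm := app PRSymb.add ![t, s]
/-- The term for a reversed truncated difference. -/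
def rsub (t s : Tm) : Tm := app PRSymb.rsub ![t, s]
/-- The term for a triangular number. -/
def tri (t : Tm) : Tm := app PRSymb.tri ![t]
/-- The term for a case distinction. -/
def ite (t s r : Tm) : Tm := app PRSymb.ite ![t, s, r]
/-- The term for the number of a diagonal. -/
def diag (t : Tm) : Tm := app PRSymb.diag ![t]
/-- The term for the code of a pair. -/
def pair (t s : Tm) : Tm := app PRSymb.pair ![t, s]
/-- The term for a first component. -/
def fst (t : Tm) : Tm := app PRSymb.fst ![t]
/-- The term for a second component. -/
def snd (t : Tm) : Tm := app PRSymb.snd ![t]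

variable (t s r : Tm) (σ : ℕ → Tm)

@[simp] theorem subst_add : (add t s).subst σ = add (t.subst σ) (s.subst σ) := by simp [add]
@[simp] theorem subst_rsub : (rsub t s).subst σ = rsub (t.subst σ) (s.subst σ) := by simp [rsub]
@[simp] theorem subst_tri : (tri t).subst σ = tri (t.subst σ) := by simp [tri]
@[simp] theorem subst_diag : (diag t).subst σ = diag (t.subst σ) := by simp [diag]
@[simp] theorem subst_fst : (fst t).subst σ = fst (t.subst σ) := by simp [fst]
@[simp] theorem subst_snd : (snd t).subst σ = snd (t.subst σ) := by simp [snd]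

end Tm

namespace Formula

/-- The substitution `0 ↦ S 0`. -/
def bump : ℕ → Tm
  | 0 => Tm.succ (Tm.v 0)
  | n + 1 => Tm.v (n + 1)

@[simp] theorem bump_zero : bump 0 = Tm.succ (Tm.v 0) := rfl
@[simp] theorem bump_succ (n : ℕ) : bump (n + 1) = Tm.v (n + 1) := rfl

theorem atSucc_eq (φ : Formula) : φ.atSucc = φ.subst bump := by
  unfold atSucc
  congr 1

end Formula

/-! ### Pairing in Heyting arithmetic -/

section Arithmetic

open Tm

variable {T : Set Formula} {Γ : List Formula}

theorem induct (hT : HA ⊆ T) (φ : Formula) (t : Tm) (hz : Deriv T Γ (φ.inst Tm.zero))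
    (hs : Deriv T (φ :: Γ.map shift) (φ.subst bump)) : Deriv T Γ (φ.inst t) := by
  rw [← atSucc_eq] at hs
  exact allE t (impE (impE (ax (hT (HA.induction φ))) hz) (allI (impI hs)))

variable (hT : HA ⊆ T)
include hT

theorem eq_proj {n : ℕ} (i : Fin n) (ts : Fin n → Tm) :
    EqD T Γ (app (PRSymb.proj i) ts) (ts i) := ax (hT (HA.proj i ts))

theorem eq_comp {n m : ℕ} (f : PRSymb m) (g : Fin m → PRSymb n) (ts : Fin n → Tm) :
    EqD T Γ (app (PRSymb.comp f g) ts) (app f fun i => app (g i) ts) :=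
  ax (hT (HA.comp f g ts))

theorem eq_comp1 {n : ℕ} (f : PRSymb 1) (g : PRSymb n) (ts : Fin n → Tm) :
    EqD T Γ (app (PRSymb.comp f ![g]) ts) (app f ![app g ts]) := by
  have := eq_comp (Γ := Γ) hT f ![g] ts
  rwa [show (fun i => app (![g] i) ts) = ![app g ts] by funext i; fin_cases i; rfl] at this

theorem eq_comp2 {n : ℕ} (f : PRSymb 2) (g h : PRSymb n) (ts : Fin n → Tm) :
    EqD T Γ (app (PRSymb.comp f ![g, h]) ts) (app f ![app g ts, app h ts]) := by
  have := eq_comp (Γ := Γ) hT f ![g, h] ts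
  rwa [show (fun i => app (![g, h] i) ts) = ![app g ts, app h ts] by
    funext i; fin_cases i <;> rfl] at this

theorem eq_comp3 {n : ℕ} (f : PRSymb 3) (g h k : PRSymb n) (ts : Fin n → Tm) :
    EqD T Γ (app (PRSymb.comp f ![g, h, k]) ts) (app f ![app g ts, app h ts, app k ts]) := by
  have := eq_comp (Γ := Γ) hT f ![g, h, k] ts
  rwa [show (fun i => app (![g, h, k] i) ts) = ![app g ts, app h ts, app k ts] by
    funext i; fin_cases i <;> rfl] at this

theorem eq_comp_succ {n : ℕ} (g : PRSymb n) (ts : Fin n → Tm) :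
    EqD T Γ (app (PRSymb.comp PRSymb.succ ![g]) ts) (Tm.succ (app g ts)) := by
  rw [succ_eq]
  exact eq_comp1 hT _ _ _

/-- `Matrix.vecCons` replaces the definitionally equal `Fin.cons` of the axiom, so that literals
`![…]` match. -/
theorem eq_prec_zero {n : ℕ} (f : PRSymb n) (g : PRSymb (n + 2)) (ts : Fin n → Tm) :
    EqD T Γ (app (PRSymb.prec f g) (Matrix.vecCons Tm.zero ts)) (app f ts) :=
  ax (hT (HA.prec_zero f g ts))

theorem eq_prec_succ {n : ℕ} (f : PRSymb n) (g : PRSymb (n + 2)) (t : Tm) (ts : Fin n → Tm) :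
    EqD T Γ (app (PRSymb.prec f g) (Matrix.vecCons (Tm.succ t) ts))
      (app g (Matrix.vecCons t
        (Matrix.vecCons (app (PRSymb.prec f g) (Matrix.vecCons t ts)) ts))) :=
  ax (hT (HA.prec_succ f g t ts))

theorem eq_prec_zero' (g : PRSymb 2) :
    EqD T Γ (app (PRSymb.prec PRSymb.zero g) ![Tm.zero]) Tm.zero := by
  have := eq_prec_zero (Γ := Γ) hT PRSymb.zero g ![]
  rwa [show app PRSymb.zero ![] = Tm.zero from
    congrArg (app PRSymb.zero) (Subsingleton.elim _ _)] at this

theorem pred_succ (t : Tm) : EqD T Γ (pred (Tm.succ t)) t :=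
  (eq_prec_succ hT _ _ t ![]).trans (eq_proj hT _ _)

theorem zero_add (t : Tm) : EqD T Γ (add Tm.zero t) t :=
  (eq_prec_zero hT _ _ ![t]).trans (eq_proj hT _ _)

theorem succ_add (t s : Tm) : EqD T Γ (add (Tm.succ t) s) (Tm.succ (add t s)) :=
  (eq_prec_succ hT _ _ t ![s]).trans ((eq_comp_succ hT _ _).trans (eq_proj hT _ _).succ)

theorem rsub_zero (t : Tm) : EqD T Γ (rsub Tm.zero t) t :=
  (eq_prec_zero hT _ _ ![t]).trans (eq_proj hT _ _)

theorem rsub_succ (t s : Tm) : EqD T Γ (rsub (Tm.succ t) s) (pred (rsub t s)) :=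
  (eq_prec_succ hT _ _ t ![s]).trans ((eq_comp1 hT _ _ _).trans ((eq_proj hT _ _).app1 _))

theorem tri_zero : EqD T Γ (tri Tm.zero) Tm.zero := eq_prec_zero' hT _

theorem tri_succ (t : Tm) : EqD T Γ (tri (Tm.succ t)) (Tm.succ (add t (tri t))) :=
  (eq_prec_succ hT _ _ t ![]).trans ((eq_comp_succ hT _ _).trans
    ((eq_comp2 hT _ _ _ _).trans (EqD.app2 _ (eq_proj hT _ _) (eq_proj hT _ _))).succ)

theorem ite_zero (t s : Tm) : EqD T Γ (ite Tm.zero t s) t :=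
  (eq_prec_zero hT _ _ ![t, s]).trans (eq_proj hT _ _)

theorem ite_succ (c t s : Tm) : EqD T Γ (ite (Tm.succ c) t s) s :=
  (eq_prec_succ hT _ _ c ![t, s]).trans (eq_proj hT _ _)

theorem diag_zero : EqD T Γ (diag Tm.zero) Tm.zero := eq_prec_zero' hT _

theorem diag_succ (t : Tm) : EqD T Γ (diag (Tm.succ t))
    (ite (rsub (Tm.succ t) (tri (Tm.succ (diag t)))) (Tm.succ (diag t)) (diag t)) := by
  refine (eq_prec_succ hT _ _ t ![]).trans ((eq_comp3 hT _ _ _ _ _).trans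
    (EqD.app3 _ ((eq_comp2 hT _ _ _ _).trans (EqD.app2 _ ?_ ?_)) ?_ ?_))
  · exact (eq_comp_succ hT _ _).trans (eq_proj hT _ _).succ
  · exact (eq_comp1 hT _ _ _).trans
      (EqD.app1 _ ((eq_comp_succ hT _ _).trans (eq_proj hT _ _).succ))
  · exact (eq_comp_succ hT _ _).trans (eq_proj hT _ _).succ
  · exact eq_proj hT _ _

theorem pair_eq (t s : Tm) : EqD T Γ (pair t s) (add t (tri (add t s))) :=
  (eq_comp2 hT _ _ _ _).trans (EqD.app2 _ (eq_proj hT _ _) (eq_comp1 hT _ _ _))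

theorem fst_eq (t : Tm) : EqD T Γ (fst t) (rsub (tri (diag t)) t) :=
  (eq_comp2 hT _ _ _ _).trans (EqD.app2 _ (eq_comp1 hT _ _ _) (eq_proj hT _ _))

theorem snd_eq (t : Tm) : EqD T Γ (snd t) (rsub (fst t) (diag t)) := eq_comp2 hT _ _ _ _

omit hT in
theorem add_congr {a a' b b' : Tm} (h : EqD T Γ a a') (h' : EqD T Γ b b') :
    EqD T Γ (add a b) (add a' b') := EqD.app2 _ h h'

omit hT in
theorem rsub_congr {a a' b b' : Tm} (h : EqD T Γ a a') (h' : EqD T Γ b b') :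
    EqD T Γ (rsub a b) (rsub a' b') := EqD.app2 _ h h'

theorem add_succ (t s : Tm) : EqD T Γ (add t (Tm.succ s)) (Tm.succ (add t s)) := by
  -- Variable `0` is the induction variable, so the parameter `s` is shifted; instantiation undoes
  -- the shift.
  have := induct (Γ := Γ) hT (eq (add (v 0) (Tm.succ (s.subst fun n => v (n + 1))))
    (Tm.succ (add (v 0) (s.subst fun n => v (n + 1))))) t
  simp only [inst, subst, subst_add, subst_v, single_zero, subst_succ, Tm.subst_subst, single_succ,
    Tm.subst_v_id, bump_zero, bump_succ] at this
  exact this ((zero_add hT _).trans (zero_add hT _).symm.succ)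
    ((succ_add hT _ _).trans ((EqD.succ h0).trans (succ_add hT _ _).symm.succ))

theorem add_zero (t : Tm) : EqD T Γ (add t Tm.zero) t := by
  have := induct (Γ := Γ) hT (eq (add (v 0) Tm.zero) (v 0)) t
  simp only [inst, subst, subst_add, subst_v, single_zero, subst_zero, bump_zero] at this
  exact this (zero_add hT _) ((succ_add hT _ _).trans (EqD.succ h0))

theorem rsub_succ_succ (t s : Tm) : EqD T Γ (rsub (Tm.succ t) (Tm.succ s)) (rsub t s) := by
  have := induct (Γ := Γ) hT (eq (rsub (Tm.succ (v 0)) (Tm.succ (s.subst fun n => v (n + 1))))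
    (rsub (v 0) (s.subst fun n => v (n + 1)))) t
  simp only [inst, subst, subst_rsub, subst_v, single_zero, subst_succ, Tm.subst_subst, single_succ,
    Tm.subst_v_id, bump_zero, bump_succ] at this
  refine this ?_ ?_
  · exact (rsub_succ hT _ _).trans ((EqD.app1 _ (rsub_zero hT _)).trans
      ((pred_succ hT _).trans (rsub_zero hT _).symm))
  · exact (rsub_succ hT _ _).trans ((EqD.app1 _ h0).trans (rsub_succ hT _ _).symm)

/-- `x + y - x = y`. -/
theorem rsub_add_left (t s : Tm) : EqD T Γ (rsub t (add t s)) s := by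
  have := induct (Γ := Γ) hT (eq (rsub (v 0) (add (v 0) (s.subst fun n => v (n + 1))))
    (s.subst fun n => v (n + 1))) t
  simp only [inst, subst, subst_rsub, subst_add, subst_v, single_zero, Tm.subst_subst, single_succ,
    Tm.subst_v_id, bump_zero, bump_succ] at this
  refine this ((rsub_zero hT _).trans (zero_add hT _)) ?_
  exact (rsub_congr (eqI _) (succ_add hT _ _)).trans ((rsub_succ_succ hT _ _).trans h0)

/-- `y + x - x = y`. -/
theorem rsub_add_right (t s : Tm) : EqD T Γ (rsub t (add s t)) s := by
  have := induct (Γ := Γ) hT (eq (rsub (v 0) (add (s.subst fun n => v (n + 1)) (v 0)))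
    (s.subst fun n => v (n + 1))) t
  simp only [inst, subst, subst_rsub, subst_add, subst_v, single_zero, Tm.subst_subst, single_succ,
    Tm.subst_v_id, bump_zero, bump_succ] at this
  refine this ((rsub_zero hT _).trans (add_zero hT _)) ?_
  exact (rsub_congr (eqI _) (add_succ hT _ _)).trans ((rsub_succ_succ hT _ _).trans h0)

theorem rsub_self (t : Tm) : EqD T Γ (rsub t t) Tm.zero :=
  (rsub_congr (eqI _) (zero_add hT t).symm).trans (rsub_add_right hT t _)

/-- `(x + y + z) - (x + z) = y`. -/
theorem rsub_add_add (t s r : Tm) : EqD T Γ (rsub (add t r) (add (add t s) r)) s := by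
  have := induct (Γ := Γ) hT (eq (rsub (add (v 0) (r.subst fun n => v (n + 1)))
    (add (add (v 0) (s.subst fun n => v (n + 1))) (r.subst fun n => v (n + 1))))
    (s.subst fun n => v (n + 1))) t
  simp only [inst, subst, subst_rsub, subst_add, subst_v, single_zero, Tm.subst_subst, single_succ,
    Tm.subst_v_id, bump_zero, bump_succ] at this
  refine this ?_ ?_
  · exact (rsub_congr (zero_add hT _) (add_congr (zero_add hT _) (eqI _))).trans
      (rsub_add_right hT _ _)
  · refine (rsub_congr (succ_add hT _ _) ((add_congr (succ_add hT _ _) (eqI _)).trans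
      (succ_add hT _ _))).trans ((rsub_succ_succ hT _ _).trans h0)

/-- Since `tri (s + 1) = (s + tri s) + 1`, the test whether `t + 1` has reached the next triangular
number loses a successor on both sides. -/
theorem diag_step {t s : Tm} (h : EqD T Γ (diag t) s) : EqD T Γ (diag (Tm.succ t))
    (ite (rsub t (add s (tri s))) (Tm.succ s) s) := by
  refine (diag_succ hT _).trans (EqD.app3 _ ?_ h.succ h)
  exact (rsub_congr (eqI _) ((EqD.app1 _ h.succ).trans (tri_succ hT _))).trans
    (rsub_succ_succ hT _ _)

/-- The code `x + tri n` lies on the diagonal `n` if `x ≤ n`, provided that `tri n` does. -/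
theorem diag_add_tri {n t : Tm} (h : EqD T Γ (diag (tri n)) n)
    (ht : EqD T Γ (add t (rsub t n)) n) : EqD T Γ (diag (add t (tri n))) n := by
  -- `x ≤ n` is expressed by the equation `x + (n - x) = n` and made the premise of the induction
  -- formula.
  have := induct (Γ := Γ) hT
    (imp (eq (add (v 0) (rsub (v 0) (n.subst fun n => v (n + 1)))) (n.subst fun n => v (n + 1)))
      (eq (diag (add (v 0) (tri (n.subst fun n => v (n + 1))))) (n.subst fun n => v (n + 1)))) t
  simp only [inst, subst, subst_rsub, subst_add, subst_diag, subst_tri, subst_v, single_zero,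
    Tm.subst_subst, single_succ, Tm.subst_v_id, bump_zero, bump_succ] at this
  refine impE (this (impI (wk ((EqD.app1 _ (zero_add hT _)).trans h))) (impI ?_)) ht
  generalize (n.subst fun n => v (n + 1)) = m
  set x := v 0
  set y := rsub (Tm.succ x) m
  set Δ := _ :: _
  -- With `y = m - (x + 1)`, the premise for `x + 1` yields `x + (y + 1) = m`, hence the premise for
  -- `x`.
  have e : EqD T Δ (add x (Tm.succ y)) m :=
    (add_succ hT _ _).trans ((succ_add hT _ _).symm.trans h0)
  have e' : EqD T Δ (rsub x m) (Tm.succ y) :=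
    (rsub_congr (eqI _) e.symm).trans (rsub_add_left hT _ _)
  have ih : EqD T Δ (diag (add x (tri m))) m := impE h1 ((add_congr (eqI _) e').trans e)
  refine (EqD.app1 _ (succ_add hT _ _)).trans ((diag_step hT ih).trans ?_)
  -- The test value is `(m + tri m) - (x + tri m) = y + 1`, not zero, so the diagonal stays `m`.
  refine (EqD.app3 _ ?_ (eqI _) (eqI _)).trans (ite_succ hT y _ _)
  exact (rsub_congr (eqI _) (add_congr e.symm (eqI _))).trans (rsub_add_add hT _ _ _)

/-- The predecessor of `tri (n + 1)` is `n + tri n`, the last code on diagonal `n`. There the test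
value is zero, and the diagonal number increases. -/
theorem diag_tri (t : Tm) : EqD T Γ (diag (tri t)) t := by
  have := induct (Γ := Γ) hT (eq (diag (tri (v 0))) (v 0)) t
  simp only [inst, subst, subst_diag, subst_tri, subst_v, single_zero, bump_zero] at this
  refine this ((EqD.app1 _ (tri_zero hT)).trans (diag_zero hT)) ?_
  refine (EqD.app1 _ (tri_succ hT _)).trans ((diag_step hT (diag_add_tri hT h0 ?_)).trans ?_)
  · exact (add_congr (eqI _) (rsub_self hT _)).trans (add_zero hT _)
  · exact (EqD.app3 _ (rsub_self hT _) (eqI _) (eqI _)).trans (ite_zero hT _ _)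

theorem diag_pair (t s : Tm) : EqD T Γ (diag (pair t s)) (add t s) :=
  (EqD.app1 _ (pair_eq hT _ _)).trans (diag_add_tri hT (diag_tri hT _)
    (add_congr (eqI _) (rsub_add_left hT _ _)))

theorem fst_pair (t s : Tm) : EqD T Γ (fst (pair t s)) t :=
  (fst_eq hT _).trans ((rsub_congr (EqD.app1 _ (diag_pair hT _ _)) (pair_eq hT _ _)).trans
    (rsub_add_right hT _ _))

theorem snd_pair (t s : Tm) : EqD T Γ (snd (pair t s)) s :=
  (snd_eq hT _).trans ((rsub_congr (fst_pair hT _ _) (diag_pair hT _ _)).trans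
    (rsub_add_left hT _ _))

end Arithmetic

end Arith

namespace Arith

open Formula Deriv

/-! ### Quantifiers of a given sign and prenex classes -/

/-- The quantifier of sign `b`: existential for `true`, universal for `false`. -/
def Formula.qn : Bool → Formula → Formula
  | true => ex
  | false => all

theorem mem_FV_qn (b : Bool) (φ : Formula) (m : ℕ) : m ∈ (qn b φ).FV ↔ m + 1 ∈ φ.FV := by
  cases b <;> rfl

theorem subst_qn (b : Bool) (φ : Formula) (σ : ℕ → Tm) :
    (qn b φ).subst σ = qn b (φ.subst (up σ)) := by
  cases b <;> rfl

theorem subst_qn_iterate (b : Bool) (n : ℕ) (φ : Formula) (σ : ℕ → Tm) :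
    ((qn b)^[n] φ).subst σ = (qn b)^[n] (φ.subst (up^[n] σ)) := by
  induction n generalizing σ with
  | zero => rfl
  | succ n ih => rw [Function.iterate_succ_apply', subst_qn, ih, Function.iterate_succ_apply',
      Function.iterate_succ_apply]

theorem FV_qn_shift (b : Bool) (φ : Formula) : (qn b φ.shift).FV = φ.FV := by
  ext m; rw [mem_FV_qn, mem_FV_shift]

theorem FV_qn_congr (b : Bool) {φ ψ : Formula} (h : φ.FV = ψ.FV) :
    (qn b φ).FV = (qn b ψ).FV := by
  ext m; rw [mem_FV_qn, mem_FV_qn, h]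

theorem FV_qn_iterate_congr (b : Bool) (n : ℕ) {φ ψ : Formula} (h : φ.FV = ψ.FV) :
    ((qn b)^[n] φ).FV = ((qn b)^[n] ψ).FV := by
  induction n with
  | zero => exact h
  | succ n ih =>
    rw [Function.iterate_succ_apply', Function.iterate_succ_apply']
    exact FV_qn_congr b ih

/-- Prenex formulas with `k` alternating blocks, the first one of sign `b`. -/
def Cl : Bool → ℕ → Set Formula
  | _, 0 => {φ | φ.QF}
  | b, k + 1 => {φ | ∃ ψ ∈ Cl (!b) k, ∃ n : ℕ, φ = (qn b)^[n + 1] ψ}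

theorem Cl_eq (k : ℕ) : Cl true k = SigmaCl k ∧ Cl false k = PiCl k := by
  induction k with
  | zero => simp [Cl, SigmaCl, PiCl]
  | succ k ih => simp [Cl, SigmaCl, PiCl, ih.1, ih.2, qn]

theorem QF_subst {φ : Formula} (h : φ.QF) (σ : ℕ → Tm) : (φ.subst σ).QF := by
  induction φ with
  | bot | eq => trivial
  | and _ _ h₁ h₂ | or _ _ h₁ h₂ | imp _ _ h₁ h₂ => exact ⟨h₁ h.1, h₂ h.2⟩
  | all | ex => exact h.elim

theorem Cl_subst {b : Bool} {k : ℕ} {φ : Formula} (h : φ ∈ Cl b k) (σ : ℕ → Tm) :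
    φ.subst σ ∈ Cl b k := by
  induction k generalizing b φ σ with
  | zero => exact QF_subst h σ
  | succ k ih =>
    obtain ⟨ψ, hψ, n, rfl⟩ := h
    exact ⟨_, ih hψ _, n, subst_qn_iterate b (n + 1) ψ σ⟩

theorem Cl_qn {b : Bool} {k : ℕ} {φ : Formula} (h : φ ∈ Cl b (k + 1)) : qn b φ ∈ Cl b (k + 1) := by
  obtain ⟨ψ, hψ, n, rfl⟩ := h
  exact ⟨ψ, hψ, n + 1, (Function.iterate_succ_apply' _ _ _).symm⟩

/-! ### Stability, equivalence, and representation up to double negation -/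

/-- `T ⊢ ¬¬φ → φ`. -/
def Stable (T : Set Formula) (φ : Formula) : Prop := Proves T (imp φ.neg.neg φ)

/-- `T ⊢ φ ↔ ψ`, as a pair of implications. -/
def Equiv (T : Set Formula) (φ ψ : Formula) : Prop :=
  Proves T (imp φ ψ) ∧ Proves T (imp ψ φ)

/-- `T ⊢ δ → φ` and `T ⊢ φ → ¬¬δ`. -/
def Repr (T : Set Formula) (δ φ : Formula) : Prop :=
  Proves T (imp δ φ) ∧ Proves T (imp φ δ.neg.neg)

section

variable {T T' : Set Formula} {φ ψ χ δ ε α γ : Formula}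

theorem Equiv.mk (h : Deriv T [φ] ψ) (h' : Deriv T [ψ] φ) : Equiv T φ ψ := ⟨impI h, impI h'⟩

theorem Equiv.refl (T : Set Formula) (φ : Formula) : Equiv T φ φ := .mk h0 h0

theorem Equiv.qn (b : Bool) (h : Equiv T φ ψ) : Equiv T (qn b φ) (qn b ψ) := by
  cases b with
  | true => exact .mk (exE h0 (exI_v (mp h.1 h0))) (exE h0 (exI_v (mp h.2 h0)))
  | false => exact .mk (allI (mp h.1 (allE_v h0))) (allI (mp h.2 (allE_v h0)))

theorem Equiv.qn_iterate (b : Bool) (n : ℕ) (h : Equiv T φ ψ) :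
    Equiv T ((Formula.qn b)^[n] φ) ((Formula.qn b)^[n] ψ) := by
  induction n with
  | zero => exact h
  | succ n ih =>
    rw [Function.iterate_succ_apply', Function.iterate_succ_apply']
    exact ih.qn b

theorem equiv_dummy (T : Set Formula) (b : Bool) (φ : Formula) : Equiv T (qn b φ.shift) φ := by
  have key : ∀ {Γ} , Deriv T Γ φ → Deriv T Γ (φ.shift.inst Tm.zero) := by
    intro Γ h; rwa [shift_inst]
  cases b with
  | true => exact .mk (exE h0 h0) (exI Tm.zero (key h0))
  | false =>
    refine .mk ?_ (allI h0)
    have := allE Tm.zero (T := T) (h0 (φ := all φ.shift) (Γ := []))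
    rwa [shift_inst] at this

theorem Repr.mk (h : Deriv T [δ] φ) (h' : Deriv T [δ.neg, φ] bot) : Repr T δ φ :=
  ⟨impI h, impI (impI h')⟩

theorem Equiv.repr (h : Equiv T δ φ) : Repr T δ φ := .mk (mp h.1 h0) (impE h0 (mp h.2 h1))

theorem Repr.refl (T : Set Formula) (φ : Formula) : Repr T φ φ := (Equiv.refl T φ).repr

theorem Repr.mono (h : Repr T δ φ) (hT : ∀ χ ∈ T, Proves T' χ) : Repr T' δ φ :=
  ⟨h.1.change_axioms hT, h.2.change_axioms hT⟩

theorem Repr.trans (h : Repr T δ ε) (h' : Repr T ε φ) : Repr T δ φ :=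
  .mk (mp h'.1 (mp h.1 h0)) (impE (mp h'.2 h1) (impI (impE (mp h.2 h0) h1)))

theorem Repr.equiv (h : Repr T δ φ) (hδ : Stable T δ) : Equiv T φ δ :=
  .mk (mp hδ (mp h.2 h0)) (mp h.1 h0)

theorem Equiv.proves_iff (h : Equiv T φ ψ) : Proves T (iff φ ψ) := andI h.1 h.2

theorem Repr.and (h : Repr T δ φ) (h' : Repr T ε ψ) : Repr T (and δ ε) (and φ ψ) :=
  .mk (andI (mp h.1 (andE₁ h0)) (mp h'.1 (andE₂ h0)))
    (impE (mp h.2 (andE₁ h1)) (impI (impE (mp h'.2 (andE₂ h2)) (impI (impE h2 (andI h1 h0))))))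

/-- From `φ` only `¬¬δ` is available. A stable `δ` turns this into `δ`; otherwise `δ → ε` gives
`¬¬ε`, and a stable `ε` absorbs the double negation. The other half needs no stability: `¬(δ → ε)`
and `φ → ψ` refute `δ`, and `¬δ` gives `δ → ε`. -/
theorem Repr.imp (h : Repr T δ φ) (h' : Repr T ε ψ) (hs : Stable T δ ∨ Stable T ε) :
    Repr T (imp δ ε) (imp φ ψ) := by
  refine .mk (impI (mp h'.1 ?_)) ?_
  · rcases hs with hs | hs
    · exact impE h1 (mp hs (mp h.2 h0))
    · exact mp hs (impI (impE (mp h.2 h1) (impI (impE h1 (impE (hyp (by simp)) h0)))))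
  · have hδ : Deriv T [(Formula.imp δ ε).neg, Formula.imp φ ψ] δ.neg :=
      impI (impE (mp h'.2 (impE h2 (mp h.1 h0))) (impI (impE h2 (impI h1))))
    exact impE h0 (impI (botE (impE (wk hδ) h0)))

theorem Repr.ex (h : Repr T δ φ) : Repr T (ex δ) (ex φ) :=
  .mk (exE h0 (exI_v (mp h.1 h0)))
    (exE h1 (impE (mp h.2 h0) (impI (impE (φ := (Formula.ex δ).shift) h2 (exI_v h0)))))

/-- Without stability this would require the double negation shift from `∀ x ¬¬δ` to `¬¬∀ x δ`. -/
theorem Repr.all (h : Repr T δ φ) (hδ : Stable T δ) : Repr T (all δ) (all φ) :=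
  have e := (h.equiv hδ).qn false
  Equiv.repr ⟨e.2, e.1⟩

theorem Stable.all (h : Stable T φ) : Stable T (all φ) :=
  impI (allI (mp h (impI (impE (φ := (Formula.all φ).neg.shift) h1
    (impI (impE h1 (allE_v h0)))))))

theorem Stable.congr (h : Stable T δ) (e : Equiv T φ δ) : Stable T φ :=
  impI (mp e.2 (mp h (impI (impE h1 (impI (impE h1 (mp e.1 h0)))))))

/-! ### Prenex operations for a single quantifier -/

theorem repr_and_left (b : Bool) : Repr T (qn b (and α γ.shift)) (and (qn b α) γ) := by
  apply Equiv.repr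
  cases b with
  | true =>
    exact .mk (exE h0 (andI (φ := (ex α).shift) (ψ := γ.shift) (exI_v (andE₁ h0)) (andE₂ h0)))
      (exE (andE₁ h0) (exI_v (andI h0 (andE₂ (φ := (ex α).shift) h1))))
  | false =>
    refine .mk (andI (allI (andE₁ (allE_v h0))) ?_)
      (allI (andI (allE_v (andE₁ (ψ := γ.shift) h0)) (andE₂ (φ := (all α).shift) h0)))
    have := andE₂ (φ := α.inst Tm.zero) (ψ := γ.shift.inst Tm.zero)
      (allE Tm.zero (T := T) (h0 (φ := all (and α γ.shift)) (Γ := [])))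
    rwa [shift_inst] at this

theorem repr_and_right (b : Bool) : Repr T (qn b (and α.shift γ)) (and α (qn b γ)) := by
  have comm : ∀ φ ψ : Formula, Equiv T (and φ ψ) (and ψ φ) := fun φ ψ =>
    .mk (andI (andE₂ h0) (andE₁ h0)) (andI (andE₂ h0) (andE₁ h0))
  exact ((comm _ _).qn b).repr.trans ((repr_and_left b).trans (comm _ _).repr)

theorem repr_ex_imp : Repr T (all (imp α γ.shift)) (imp (ex α) γ) :=
  Equiv.repr (.mk (impI (exE h0 (impE (allE_v (φ := imp α γ.shift) h2) h0)))
    (allI (impI (impE (φ := (ex α).shift) h1 (exI_v h0)))))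

theorem repr_imp_all : Repr T (all (imp α.shift γ)) (imp α (all γ)) :=
  Equiv.repr (.mk (impI (allI (impE (allE_v (φ := imp α.shift γ) h1) h0)))
    (allI (impI (allE_v (impE (φ := α.shift) h1 h0)))))

/-- If no `x` satisfies `α → γ`, then no `x` satisfies `¬α`. So stability yields `∀ x α`, hence `γ`,
and then any witness serves, here `0`. -/
theorem repr_all_imp (hα : Stable T α) : Repr T (ex (imp α γ.shift)) (imp (all α) γ) := by
  refine .mk (impI (exE h1 (impE h0 (allE_v h1)))) ?_
  have hγ : Deriv T [(ex (imp α γ.shift)).neg, imp (all α) γ] γ :=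
    impE h1 (allI (mp hα (impI (impE (φ := (ex (imp α γ.shift)).shift) h1
      (exI_v (impI (botE (impE h1 h0))))))))
  refine impE h0 (exI Tm.zero (impI (φ := α.inst Tm.zero) (ψ := γ.shift.inst Tm.zero) (wk ?_)))
  rwa [shift_inst]

/-- If no `x` satisfies `α → γ`, then `α` is refuted, since it would supply a witness; but `¬α`
makes the witness `0` work. -/
theorem repr_imp_ex : Repr T (ex (imp α.shift γ)) (imp α (ex γ)) := by
  refine .mk (impI (exE h1 (exI_v (impE h0 h1)))) ?_
  have hα : Deriv T [(ex (imp α.shift γ)).neg, imp α (ex γ)] α.neg :=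
    impI (exE (impE h2 h0) (impE (φ := (ex (imp α.shift γ)).shift) h2 (exI_v (impI h1))))
  refine impE h0 (exI Tm.zero (impI (φ := α.shift.inst Tm.zero) (ψ := γ.inst Tm.zero) ?_))
  rw [shift_inst]
  exact botE (impE (wk hα) h0)

end

end Arith

namespace Arith

open Formula Deriv

/-! ### Double negation elimination with several parameters -/

/-- The substitution that decodes the variable `0` as a pair, to be used for the variables
`0` and `1`. -/
def unpair : ℕ → Tm
  | 0 => Tm.fst (Tm.v 0)
  | 1 => Tm.snd (Tm.v 0)
  | n + 2 => Tm.v (n + 1)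

/-- The substitution `σ`, with the terms for the variables `0` and `1` combined to a pair. -/
def mergePair (σ : ℕ → Tm) : ℕ → Tm
  | 0 => Tm.pair (σ 0) (σ 1)
  | n + 1 => σ (n + 2)

/-- The substitution `0 ↦ t`, `1 ↦ s`, `n + 2 ↦ σ (n + 2)`. -/
def setTwo (t s : Tm) (σ : ℕ → Tm) : ℕ → Tm
  | 0 => t
  | 1 => s
  | n + 2 => σ (n + 2)

theorem unpair_mergePair (σ : ℕ → Tm) : (fun n => (unpair n).subst (mergePair σ)) =
    setTwo (Tm.fst (Tm.pair (σ 0) (σ 1))) (Tm.snd (Tm.pair (σ 0) (σ 1))) σ := by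
  funext n
  match n with
  | 0 => simp [unpair, setTwo, mergePair]
  | 1 => simp [unpair, setTwo, mergePair]
  | n + 2 => rfl

theorem eqE_setTwo {T : Set Formula} {Γ : List Formula} {t t' s s' : Tm} (σ : ℕ → Tm) (φ : Formula)
    (ht : EqD T Γ t t') (hs : EqD T Γ s s') (h : Deriv T Γ (φ.subst (setTwo t s σ))) :
    Deriv T Γ (φ.subst (setTwo t' s' σ)) := by
  have e : ∀ (ρ : ℕ → Tm) (t s r : Tm), ρ = setTwo t s σ → ∀ τ : ℕ → Tm,
      (∀ n, (τ n).subst (single r) = ρ n) → (φ.subst τ).inst r = φ.subst (setTwo t s σ) := by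
    rintro ρ t s r rfl τ hτ
    rw [inst, Formula.subst_subst]
    exact congrArg (fun ρ => φ.subst ρ) (funext hτ)
  have h₁ : Deriv T Γ (φ.subst (setTwo t' s σ)) := by
    have key : ∀ r n, ((setTwo (Tm.v 0) (s.subst fun n => Tm.v (n + 1))
        fun n => (σ n).subst fun n => Tm.v (n + 1)) n).subst (single r) = setTwo r s σ n := by
      rintro r (_ | _ | n) <;> simp [setTwo]
    have := eqE (φ.subst _) ht ((e _ t s t rfl _ (key t)).symm ▸ h)
    rwa [e _ t' s t' rfl _ (key t')] at this
  have key : ∀ r n, ((setTwo (t'.subst fun n => Tm.v (n + 1)) (Tm.v 0)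
      fun n => (σ n).subst fun n => Tm.v (n + 1)) n).subst (single r) = setTwo t' r σ n := by
    rintro r (_ | _ | n) <;> simp [setTwo]
  have := eqE (φ.subst _) hs ((e _ t' s s rfl _ (key s)).symm ▸ h₁)
  rwa [e _ t' s' s' rfl _ (key s')] at this

/-- Each induction step trades two parameters for one coded pair. All substitution instances are
included so that the coded variable can be instantiated with the pair of the original terms. -/
theorem dne_subst {T : Set Formula} {j : ℕ} (hHA : HA ⊆ T) (hT : DNE (SigmaCl j) ⊆ T) (n : ℕ) :
    ∀ φ ∈ Cl true j, (∀ m ∈ φ.FV, m < n + 1) → ∀ σ,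
      Proves T ((imp φ.neg.neg φ).subst σ) := by
  induction n with
  | zero =>
    intro φ hφ hn σ
    have := allE (σ 0) (ax (Γ := []) (hT ⟨φ, (Cl_eq j).1 ▸ hφ,
      fun m hm => Nat.lt_one_iff.1 (hn m hm), rfl⟩))
    rw [inst, Formula.subst_congr (τ := σ)] at this
    · exact this
    · intro m hm
      have : m = 0 := Nat.lt_one_iff.1 (hn m (by simpa [FV, neg] using hm))
      rw [this, single_zero]
  | succ n ih =>
    intro φ hφ hn σ
    -- This gives the statement for the projections of `⟨σ 0, σ 1⟩`, which are then replaced by `σ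
    -- 0` and `σ 1`.
    have := ih (φ.subst unpair) (Cl_subst hφ _) ?_ (mergePair σ)
    · change Proves T (((imp φ.neg.neg φ).subst unpair).subst (mergePair σ)) at this
      rw [Formula.subst_subst, unpair_mergePair] at this
      have := eqE_setTwo σ _ (fst_pair hHA _ _) (snd_pair hHA _ _) this
      rwa [show setTwo (σ 0) (σ 1) σ = σ by funext n; match n with | 0 | 1 | n + 2 => rfl] at this
    · intro m hm
      obtain ⟨i, hi, hm⟩ := (mem_FV_subst _ _ _).1 hm
      have hi := hn i hi
      match i with
      | 0 =>
        simp only [unpair, Tm.fst, Tm.mem_varFinset_app, Fin.exists_fin_one] at hm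
        have := (Tm.mem_varFinset_v 0 m).1 hm
        omega
      | 1 =>
        simp only [unpair, Tm.snd, Tm.mem_varFinset_app, Fin.exists_fin_one] at hm
        have := (Tm.mem_varFinset_v 0 m).1 hm
        omega
      | i + 2 =>
        have := (Tm.mem_varFinset_v (i + 1) m).1 hm
        omega

theorem stable_of_dne {T : Set Formula} {j : ℕ} (hHA : HA ⊆ T) (hT : DNE (SigmaCl j) ⊆ T)
    {φ : Formula} (hφ : φ ∈ Cl true j) : Stable T φ := by
  obtain ⟨n, hn⟩ := exists_FV_lt φ
  have := dne_subst hHA hT n φ hφ (fun m hm => (hn m hm).trans n.lt_succ_self) Tm.v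
  rwa [Formula.subst_v_id] at this

/-! ### The theories `HA + Σ_j-DNE` for all `j < k` -/

/-- `HA` with `Σ_j-DNE` for all `j < k`. -/
def Th (k : ℕ) : Set Formula := HA ∪ ⋃ j < k, DNE (SigmaCl j)

theorem Th_mono {k l : ℕ} (h : k ≤ l) : Th k ⊆ Th l :=
  Set.union_subset_union_right _
    (Set.biUnion_subset_biUnion_left fun _ hj => lt_of_lt_of_le hj h)

theorem Repr.th_mono {k l : ℕ} (h : k ≤ l) {δ φ : Formula} (hr : Repr (Th k) δ φ) :
    Repr (Th l) δ φ := hr.mono fun _ hχ => ax (Th_mono h hχ)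

theorem stable_sigma {j k : ℕ} (h : j < k) {φ : Formula} (hφ : φ ∈ Cl true j) : Stable (Th k) φ :=
  stable_of_dne Set.subset_union_left
    (fun _ hχ => Or.inr (Set.mem_biUnion (show j ∈ {j | j < k} from h) hχ)) hφ

theorem stable_all_iterate {T : Set Formula} {φ : Formula} (h : Stable T φ) (n : ℕ) :
    Stable T ((qn false)^[n] φ) := by
  induction n with
  | zero => exact h
  | succ n ih =>
    rw [Function.iterate_succ_apply']
    exact ih.all

theorem stable_pi {j k : ℕ} (h : j < k) {φ : Formula} (hφ : φ ∈ Cl false (j + 1)) :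
    Stable (Th k) φ := by
  obtain ⟨ψ, hψ, n, rfl⟩ := hφ
  exact stable_all_iterate (stable_sigma h hψ) _

/-! ### Dummy quantifiers -/

theorem exists_dummy {b : Bool} {k : ℕ} {φ : Formula} (hφ : φ ∈ Cl b k) :
    ∃ φ' ∈ Cl (!b) (k + 1), φ'.FV = φ.FV ∧ ∀ T, Equiv T φ' φ :=
  ⟨qn (!b) φ.shift, ⟨φ.shift, by simpa [shift] using Cl_subst hφ _, 0, rfl⟩, FV_qn_shift _ _,
    fun T => equiv_dummy T _ _⟩

/-- Here the dummy quantifier goes innermost, directly in front of the quantifier-free matrix, which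
leaves the leading sign unchanged. -/
theorem exists_lift {b : Bool} {k : ℕ} {φ : Formula} (hφ : φ ∈ Cl b k) :
    ∃ φ' ∈ Cl b (k + 1), φ'.FV = φ.FV ∧ ∀ T, Equiv T φ' φ := by
  induction k generalizing b φ with
  | zero => simpa using exists_dummy (b := !b) (k := 0) hφ
  | succ k ih =>
    obtain ⟨ψ, hψ, n, rfl⟩ := hφ
    obtain ⟨ψ', hψ', hFV, he⟩ := ih hψ
    exact ⟨_, ⟨ψ', hψ', n, rfl⟩, FV_qn_iterate_congr b _ hFV, fun T => (he T).qn_iterate b _⟩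

theorem exists_lift_le {b : Bool} {j k : ℕ} (h : j ≤ k) {φ : Formula} (hφ : φ ∈ Cl b j) :
    ∃ φ' ∈ Cl b k, φ'.FV = φ.FV ∧ ∀ T, Equiv T φ' φ := by
  induction k, h using Nat.le_induction with
  | base => exact ⟨φ, hφ, rfl, fun T => Equiv.refl T φ⟩
  | succ k _ ih =>
    obtain ⟨φ', hφ', hFV, he⟩ := ih
    obtain ⟨φ'', hφ'', hFV', he'⟩ := exists_lift hφ'
    exact ⟨φ'', hφ'', hFV'.trans hFV, fun T =>
      .mk (mp (he T).1 (mp (he' T).1 h0)) (mp (he' T).2 (mp (he T).2 h0))⟩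

/-- Dummy quantifiers turn a `Σ_j` formula with `j ≤ k` into an equivalent `Σ_k` formula, so
`Σ_k-DNE` contains the lower schemes. -/
theorem th_succ_proves (k : ℕ) : ∀ χ ∈ Th (k + 1), Proves (HA ∪ DNE (SigmaCl k)) χ := by
  rintro χ (h | h)
  · exact ax (Or.inl h)
  · obtain ⟨j, hj, φ, hφ, -, rfl⟩ := Set.mem_iUnion₂.1 h
    obtain ⟨φ', hφ', -, he⟩ := exists_lift_le (Nat.le_of_lt_succ hj) ((Cl_eq j).1 ▸ hφ)
    exact allI ((stable_of_dne Set.subset_union_left Set.subset_union_right hφ').congr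
      ⟨(he _).2, (he _).1⟩)

/-! ### Prenex operations on the classes -/

/-- The common core of the cases `∧` and `→`: the outer blocks of both arguments are pulled out one
quantifier at a time, left block first, and merge into one block of sign `b`; `base` treats what
remains. In `hl` the inner formula is restricted to blocks over `A` because the rule for `∀` in a
premise needs stability. -/
theorem merge_blocks {T : Set Formula} {op : Formula → Formula → Formula} {b b₁ b₂ : Bool}
    {A B D : Set Formula} (hA : ∀ α ∈ A, ∀ σ, α.subst σ ∈ A) (hB : ∀ γ ∈ B, ∀ σ, γ.subst σ ∈ B)
    (hq : ∀ δ ∈ D, ∀ n φ, Repr T ((qn b)^[n] δ) φ → Repr T (qn b ((qn b)^[n] δ)) (qn b φ))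
    (hl : ∀ α ∈ A, ∀ n γ, Repr T (qn b (op ((qn b₁)^[n] α) γ.shift))
      (op (qn b₁ ((qn b₁)^[n] α)) γ))
    (hr : ∀ α γ, Repr T (qn b (op α.shift γ)) (op α (qn b₂ γ)))
    (base : ∀ α ∈ A, ∀ γ ∈ B, ∃ δ ∈ D, δ.FV = α.FV ∪ γ.FV ∧ Repr T δ (op α γ)) (n m : ℕ) :
    ∀ α ∈ A, ∀ γ ∈ B, ∃ δ ∈ D,
      ((qn b)^[n + m] δ).FV = ((qn b₁)^[n] α).FV ∪ ((qn b₂)^[m] γ).FV ∧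
      Repr T ((qn b)^[n + m] δ) (op ((qn b₁)^[n] α) ((qn b₂)^[m] γ)) := by
  induction n with
  | zero =>
    induction m with
    | zero => exact base
    | succ m ih =>
      intro α hα γ hγ
      obtain ⟨δ, hδ, hFV, h⟩ := ih α.shift (hA α hα _) γ hγ
      refine ⟨δ, hδ, ?_, ?_⟩
      · ext i
        rw [← add_assoc, Function.iterate_succ_apply', Function.iterate_succ_apply', mem_FV_qn, hFV]
        simp only [Function.iterate_zero, id, Set.mem_union, mem_FV_shift, mem_FV_qn]
      · rw [← add_assoc, Function.iterate_succ_apply', Function.iterate_succ_apply']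
        exact (hq δ hδ _ _ h).trans (hr _ _)
  | succ n ih =>
    intro α hα γ hγ
    -- The right argument passes below the extracted quantifier, so its matrix is shifted beneath
    -- its own `m` quantifiers.
    obtain ⟨δ, hδ, hFV, h⟩ := ih α hα _ (hB γ hγ (up^[m] fun n => Tm.v (n + 1)))
    have hs : (qn b₂)^[m] (γ.subst (up^[m] fun n => Tm.v (n + 1))) = ((qn b₂)^[m] γ).shift :=
      (subst_qn_iterate _ _ _ _).symm
    rw [hs] at hFV h
    refine ⟨δ, hδ, ?_, ?_⟩
    · ext i
      rw [add_right_comm, Function.iterate_succ_apply', Function.iterate_succ_apply', mem_FV_qn,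
        hFV]
      simp only [Set.mem_union, mem_FV_shift, mem_FV_qn]
    · rw [add_right_comm, Function.iterate_succ_apply', Function.iterate_succ_apply']
      exact (hq δ hδ _ _ h).trans (hl α hα _ _)

theorem repr_qn {b : Bool} {k l : ℕ} (h : k < l) {δ : Formula} (hδ : δ ∈ Cl (!b) k) (n : ℕ)
    (φ : Formula) (hr : Repr (Th l) ((qn b)^[n] δ) φ) :
    Repr (Th l) (qn b ((qn b)^[n] δ)) (qn b φ) := by
  cases b with
  | true => exact hr.ex
  | false => exact hr.all (stable_all_iterate (stable_sigma h hδ) n)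

theorem exists_and {b : Bool} {k l : ℕ} (h : k ≤ l) {α γ : Formula} (hα : α ∈ Cl b k)
    (hγ : γ ∈ Cl b k) : ∃ δ ∈ Cl b k, δ.FV = α.FV ∪ γ.FV ∧ Repr (Th l) δ (and α γ) := by
  induction k generalizing b α γ with
  | zero => exact ⟨and α γ, ⟨hα, hγ⟩, rfl, Repr.refl _ _⟩
  | succ k ih =>
    obtain ⟨α, hα, n, rfl⟩ := hα
    obtain ⟨γ, hγ, m, rfl⟩ := hγ
    obtain ⟨δ, hδ, hFV, hr⟩ := merge_blocks (T := Th l) (op := and) (b := b) (b₁ := b) (b₂ := b)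
      (fun _ h σ => Cl_subst h σ) (fun _ h σ => Cl_subst h σ)
      (fun δ hδ => repr_qn h hδ) (fun _ _ _ _ => repr_and_left b) (fun _ _ => repr_and_right b)
      (fun α hα γ hγ => ih (Nat.le_of_succ_le h) hα hγ) (n + 1) (m + 1) α hα γ hγ
    exact ⟨_, ⟨δ, hδ, n + 1 + m, rfl⟩, hFV, hr⟩

theorem exists_imp {b : Bool} {k l : ℕ} (h : k ≤ l) {α γ : Formula} (hα : α ∈ Cl (!b) k)
    (hγ : γ ∈ Cl b k) : ∃ δ ∈ Cl b k, δ.FV = α.FV ∪ γ.FV ∧ Repr (Th l) δ (imp α γ) := by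
  induction k generalizing b α γ with
  | zero => exact ⟨imp α γ, ⟨hα, hγ⟩, rfl, Repr.refl _ _⟩
  | succ k ih =>
    obtain ⟨α, hα, n, rfl⟩ := hα
    obtain ⟨γ, hγ, m, rfl⟩ := hγ
    obtain ⟨δ, hδ, hFV, hr⟩ := merge_blocks (T := Th l) (op := imp) (b := b) (b₁ := !b) (b₂ := b)
      (A := Cl (!!b) k) (B := Cl (!b) k) (D := Cl (!b) k)
      (fun _ h σ => Cl_subst h σ) (fun _ h σ => Cl_subst h σ)
      (fun δ hδ => repr_qn h hδ)
      (fun α hα n γ => by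
        -- A universal block in the premise comes out existentially; what is left of it is `∀`s over
        -- a `Σ_k` formula with `k < l`, hence stable.
        cases b with
        | true => exact repr_all_imp (stable_all_iterate (stable_sigma h hα) n)
        | false => exact repr_ex_imp)
      (fun _ _ => by
        cases b with
        | true => exact repr_imp_ex
        | false => exact repr_imp_all)
      (fun α hα γ hγ => ih (Nat.le_of_succ_le h) hα hγ) (n + 1) (m + 1) α hα γ hγ
    exact ⟨_, ⟨δ, hδ, n + 1 + m, rfl⟩, hFV, hr⟩

/-! ### Alternation paths -/

/-- The length of a path, plus one if the path begins with the sign opposite to `b`. -/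
def rank (b : Bool) : List Bool → ℕ
  | [] => 0
  | c :: s => s.length + if c = b then 1 else 2

theorem rank_perp (b : Bool) (s : List Bool) : rank b (perp s) = rank (!b) s := by
  cases s with
  | nil => rfl
  | cons c s => cases b <;> cases c <;> simp [rank, perp]

theorem rank_le (b : Bool) (s : List Bool) : rank b s ≤ s.length + 1 := by
  cases s with
  | nil => simp [rank]
  | cons c s => simp only [rank, List.length_cons]; split_ifs <;> omega

theorem rank_of_head {b : Bool} {s : List Bool} (h : s.head? = some b) : rank b s = s.length := by
  cases s with
  | nil => simp at h
  | cons c s => simp_all [rank]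

theorem rank_not_of_head {b : Bool} {s : List Bool} (h : s.head? = some b) :
    rank (!b) s = s.length + 1 := by
  cases s with
  | nil => simp at h
  | cons c s => simp_all [rank]

theorem head_of_mem_addSign {b : Bool} {A : Finset (List Bool)} {s : List Bool}
    (h : s ∈ addSign b A) : s.head? = some b := by
  simp only [addSign, Finset.mem_union, Finset.mem_filter, Finset.mem_image] at h
  rcases h with h | ⟨t, -, rfl⟩
  · exact h.2
  · rfl

theorem alt_qn (b : Bool) (φ : Formula) : alt (qn b φ) = addSign b (alt φ) := by
  cases b <;> rfl

theorem alt_nonempty (φ : Formula) : (alt φ).Nonempty := by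
  have key : ∀ (b : Bool) (A : Finset (List Bool)), A.Nonempty → (addSign b A).Nonempty := by
    rintro b A ⟨s, hs⟩
    by_cases h : s.head? = some b
    · exact ⟨s, by simp [addSign, hs, h]⟩
    · exact ⟨b :: s, by simp [addSign, hs, h]⟩
  induction φ with
  | bot | eq => simp [alt]
  | and φ ψ h₁ _ | or φ ψ h₁ _ => simpa [alt] using Or.inl h₁
  | imp φ ψ h₁ _ => cases ψ <;> simp [alt, h₁]
  | all φ ih | ex φ ih => exact key _ _ ih

/-- All alternation paths of `φ` have rank at most `k`: this is `φ ∈ E_k⁺` for `b = true`, and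
`φ ∈ U_k⁺` for `b = false`. -/
def RankLE (b : Bool) (k : ℕ) (φ : Formula) : Prop := ∀ s ∈ alt φ, rank b s ≤ k

theorem RankLE.imp {b : Bool} {k : ℕ} {φ ψ : Formula} (h : RankLE b k (imp φ ψ)) :
    RankLE (!b) k φ ∧ RankLE b k ψ := by
  have h₁ : (alt φ).image perp ⊆ alt (Formula.imp φ ψ) := by
    cases ψ <;> simp [alt]
  refine ⟨fun s hs => ?_, ?_⟩
  · rw [← rank_perp]
    exact h _ (h₁ (Finset.mem_image_of_mem _ hs))
  -- The clause for negations drops the path of `⊥`, but that path is empty and has rank `0`.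
  · by_cases hψ : ψ = bot
    · subst hψ
      intro s hs
      rw [show s = [] by simpa [alt] using hs]
      exact Nat.zero_le _
    · have h₂ : alt ψ ⊆ alt (Formula.imp φ ψ) := by
        cases ψ <;> simp_all [alt]
      exact fun s hs => h s (h₂ hs)

/-- A path that does not begin with `b` is extended by the quantifier, and the added sign pays for
the extra one in its rank. -/
theorem RankLE.body {b : Bool} {k : ℕ} {φ : Formula} (h : RankLE b (k + 1) (qn b φ)) :
    RankLE b (k + 1) φ := by
  intro s hs
  rw [RankLE, alt_qn] at h
  by_cases hb : s.head? = some b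
  · exact h s (by simp [addSign, hs, hb])
  · have := h (b :: s) (by simp [addSign, hs, hb])
    simp only [rank, if_true] at this
    exact (rank_le b s).trans this

/-- All paths begin with `b`, so each one is charged an extra unit for the sign `!b`. -/
theorem RankLE.flip {b : Bool} {k : ℕ} {φ : Formula} (h : RankLE (!b) (k + 1) (qn b φ)) :
    RankLE b k (qn b φ) := by
  intro s hs
  have hb := head_of_mem_addSign (alt_qn b φ ▸ hs)
  have := h s hs
  rw [rank_not_of_head hb] at this
  rw [rank_of_head hb]
  omega

theorem not_rankLE_zero_qn (b c : Bool) (φ : Formula) : ¬ RankLE c 0 (qn b φ) := by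
  intro h
  obtain ⟨s, hs⟩ := alt_nonempty (qn b φ)
  have hb := head_of_mem_addSign (alt_qn b φ ▸ hs)
  have := h s hs
  cases s with
  | nil => simp at hb
  | cons d s => simp only [rank] at this; split_ifs at this <;> omega

theorem QF_of_rankLE_zero {b : Bool} {φ : Formula} (h : RankLE b 0 φ) : φ.QF := by
  induction φ generalizing b with
  | bot | eq => trivial
  | and φ ψ h₁ h₂ | or φ ψ h₁ h₂ =>
    exact ⟨h₁ fun s hs => h s (Finset.mem_union_left _ hs),
      h₂ fun s hs => h s (Finset.mem_union_right _ hs)⟩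
  | imp φ ψ h₁ h₂ => exact ⟨h₁ h.imp.1, h₂ h.imp.2⟩
  | all φ => exact not_rankLE_zero_qn false b φ h
  | ex φ => exact not_rankLE_zero_qn true b φ h

theorem length_le_degree {φ : Formula} {s : List Bool} (hs : s ∈ alt φ) : s.length ≤ degree φ :=
  Finset.le_sup (f := List.length) hs

theorem rankLE_of_mem_FCl {b : Bool} {k : ℕ} {φ : Formula} (h : φ ∈ ⋃ i < k, FCl i) :
    RankLE b k φ := by
  obtain ⟨i, hi, h⟩ := Set.mem_iUnion₂.1 h
  intro s hs
  have h₁ := rank_le b s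
  have h₂ := length_le_degree hs
  rw [show degree φ = i from h] at h₂
  omega

theorem rankLE_zero_of_mem_FCl {b : Bool} {φ : Formula} (h : φ ∈ FCl 0) : RankLE b 0 φ := by
  intro s hs
  have h₂ := length_le_degree hs
  rw [show degree φ = 0 from h, Nat.le_zero, List.length_eq_zero_iff] at h₂
  rw [h₂]
  rfl

theorem rankLE_succ_of_degree {b : Bool} {k : ℕ} {φ : Formula} (h : φ ∈ FCl (k + 1))
    (hb : ∀ s ∈ alt φ, s.length = k + 1 → s.head? = some b) : RankLE b (k + 1) φ := by
  intro s hs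
  have h₂ := length_le_degree hs
  rw [show degree φ = k + 1 from h] at h₂
  by_cases e : s.length = k + 1
  · rw [rank_of_head (hb s hs e), e]
  · have := rank_le b s
    omega

theorem rankLE_of_mem_EPlus {k : ℕ} {φ : Formula} (h : φ ∈ EPlus k) : RankLE true k φ := by
  rcases h with h | h
  · cases k with
    | zero => exact rankLE_zero_of_mem_FCl h
    | succ k => exact rankLE_succ_of_degree h.1 h.2
  · exact rankLE_of_mem_FCl h

theorem rankLE_of_mem_UPlus {k : ℕ} {φ : Formula} (h : φ ∈ UPlus k) : RankLE false k φ := by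
  rcases h with h | h
  · cases k with
    | zero => exact rankLE_zero_of_mem_FCl h
    | succ k => exact rankLE_succ_of_degree h.1 h.2
  · exact rankLE_of_mem_FCl h

/-! ### The prenex normal form theorem -/

theorem exists_prenex_of_QF {φ : Formula} (h : φ.QF) (b : Bool) (k : ℕ) :
    ∃ φ' ∈ Cl b k, φ'.FV = φ.FV ∧ Repr (Th k) φ' φ := by
  obtain ⟨φ', hφ', hFV, he⟩ := exists_lift_le (b := b) (Nat.zero_le k) (φ := φ) h
  exact ⟨φ', hφ', hFV, (he _).repr⟩

/-- A quantifier of the sign of the target class joins its leading block. One of the opposite sign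
leaves a level to spare, which a dummy quantifier in front fills. -/
theorem exists_prenex_qn {φ : Formula} (b : Bool) (ih : ∀ b k, RankLE b k φ →
      ∃ φ' ∈ Cl b k, φ'.FV = φ.FV ∧ Repr (Th k) φ' φ) (c : Bool) (k : ℕ)
    (h : RankLE c k (qn b φ)) :
    ∃ φ' ∈ Cl c k, φ'.FV = (qn b φ).FV ∧ Repr (Th k) φ' (qn b φ) := by
  have same : ∀ k, RankLE b k (qn b φ) →
      ∃ φ' ∈ Cl b k, φ'.FV = (qn b φ).FV ∧ Repr (Th k) φ' (qn b φ) := by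
    rintro (_ | k) h
    · exact absurd h (not_rankLE_zero_qn _ _ _)
    · obtain ⟨φ', hφ', hFV, hr⟩ := ih b (k + 1) h.body
      refine ⟨qn b φ', Cl_qn hφ', FV_qn_congr b hFV, ?_⟩
      cases b with
      | true => exact hr.ex
      | false => exact hr.all (stable_pi k.lt_succ_self hφ')
  by_cases hc : c = b
  · exact hc ▸ same k (hc ▸ h)
  · obtain rfl : c = !b := by cases b <;> cases c <;> simp_all
    cases k with
    | zero => exact absurd h (not_rankLE_zero_qn _ _ _)
    | succ k =>
      obtain ⟨φ', hφ', hFV, hr⟩ := same k h.flip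
      obtain ⟨φ'', hφ'', hFV', he⟩ := exists_dummy hφ'
      exact ⟨φ'', hφ'', hFV'.trans hFV, (he _).repr.trans (hr.th_mono k.le_succ)⟩

theorem exists_prenex (φ : Formula) (hφ : φ.DisjFree) : ∀ b k, RankLE b k φ →
    ∃ φ' ∈ Cl b k, φ'.FV = φ.FV ∧ Repr (Th k) φ' φ := by
  induction φ with
  | bot => exact fun b k _ => exists_prenex_of_QF (φ := bot) trivial b k
  | eq t s => exact fun b k _ => exists_prenex_of_QF (φ := eq t s) trivial b k
  | and φ ψ h₁ h₂ =>
    intro b k h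
    obtain ⟨φ', hφ', hFV, hr⟩ := h₁ hφ.1 b k fun s hs => h s (Finset.mem_union_left _ hs)
    obtain ⟨ψ', hψ', hFV', hr'⟩ := h₂ hφ.2 b k fun s hs => h s (Finset.mem_union_right _ hs)
    obtain ⟨χ, hχ, hFVχ, hrχ⟩ := exists_and le_rfl hφ' hψ'
    exact ⟨χ, hχ, by rw [hFVχ, hFV, hFV']; rfl, hrχ.trans (hr.and hr')⟩
  | or => exact hφ.elim
  | imp φ ψ h₁ h₂ =>
    rintro b (_ | k) h
    -- Level `0` is separate because `Th 0` is plain `HA` and offers no stability.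
    · exact exists_prenex_of_QF (QF_of_rankLE_zero h) b 0
    obtain ⟨φ', hφ', hFV, hr⟩ := h₁ hφ.1 (!b) (k + 1) h.imp.1
    obtain ⟨ψ', hψ', hFV', hr'⟩ := h₂ hφ.2 b (k + 1) h.imp.2
    obtain ⟨χ, hχ, hFVχ, hrχ⟩ := exists_imp le_rfl hφ' hψ'
    refine ⟨χ, hχ, by rw [hFVχ, hFV, hFV']; rfl, hrχ.trans (hr.imp hr' ?_)⟩
    -- Premise and conclusion lie in dual classes, so one of them is `Π_{k+1}` and therefore stable.
    cases b with
    | true => exact Or.inl (stable_pi k.lt_succ_self hφ')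
    | false => exact Or.inr (stable_pi k.lt_succ_self hψ')
  | all φ ih => exact exists_prenex_qn false (ih hφ)
  | ex φ ih => exact exists_prenex_qn true (ih hφ)

end Arith

theorem mainTheorem7 (k : ℕ) (φ : Arith.Formula) (hφ : φ.DisjFree) :
    (φ ∈ Arith.EPlus k →
      ∃ φ' ∈ Arith.SigmaCl k, φ.FV = φ'.FV ∧
        Arith.Proves (Arith.HA ∪ Arith.DNE (Arith.SigmaCl k)) (φ.iff φ')) ∧
    (φ ∈ Arith.UPlus k →
      ∃ φ' ∈ Arith.PiCl k, φ.FV = φ'.FV ∧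
        Arith.Proves
          (Arith.HA ∪ (if k = 0 then ∅ else Arith.DNE (Arith.SigmaCl (k - 1)))) (φ.iff φ')) := by
  open Arith in
  constructor
  · intro h
    obtain ⟨φ', hφ', hFV, hr⟩ := exists_prenex φ hφ true k (rankLE_of_mem_EPlus h)
    refine ⟨φ', (Cl_eq k).1 ▸ hφ', hFV.symm, ?_⟩
    -- Only here is `Σ_k-DNE` itself used, to remove the double negation in front of the `Σ_k` form.
    exact Deriv.change_axioms ((hr.th_mono k.le_succ).equiv
      (stable_sigma k.lt_succ_self hφ')).proves_iff (th_succ_proves k)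
  · intro h
    cases k with
    | zero => exact ⟨φ, QF_of_rankLE_zero (rankLE_of_mem_UPlus h), rfl,
        (Arith.Equiv.refl _ φ).proves_iff⟩
    | succ k =>
      obtain ⟨φ', hφ', hFV, hr⟩ := exists_prenex φ hφ false (k + 1) (rankLE_of_mem_UPlus h)
      refine ⟨φ', (Cl_eq (k + 1)).2 ▸ hφ', hFV.symm, ?_⟩
      exact Deriv.change_axioms (hr.equiv (stable_pi k.lt_succ_self hφ')).proves_iff
        (by simpa using th_succ_proves k)
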